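/- **Setting.** Let $\mathbb R^{1,1}$ be two-dimensional Minkowski space-time with coordinates $(x^0,x^1)$ and metric $g=\mathrm{diag}(-1,1)$. A (future directed) causal curve is a piecewise $C^1$ curve whose velocity satisfies $g(\dot\gamma,\dot\gamma)\le 0$ and $\dot\gamma_0>0$; the trivial curve at a single point, of length $0$, is also admitted. Its length is $l(\gamma)=\int\sqrt{-g(\dot\gamma(t),\dot\gamma(t))}\,dt$, and $p\preceq q$ means that there is a causal curve from $p$ to $q$. Let $\mathcal C_{\mathcal M}$ be the set of smooth bounded real functions on $\mathbb R^{1,1}$, with all derivatives bounded, that are non-decreasing along every causal curve, and let $\mathcal S(\mathbb R^{1,1})$ be the Schwartz space. Put $$\widetilde{\mathcal A}=\begin{pmatrix}\mathrm{Span}_{\mathbb C}(\mathcal C_{\mathcal M})&\mathcal S(\mathbb R^{1,1})\\ \mathcal S(\mathbb R^{1,1})&\mathrm{Span}_{\mathbb C}(\mathcal C_{\mathcal M})\end{pmatrix},$$ a unitisation of $\mathcal S(\mathbb R^{1,1})\otimes M_2(\mathbb C)$, acting by pointwise multiplication on $\mathcal H=L^2(\mathbb R^{1,1})\otimes\mathbb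 C^2\otimes\mathbb C^2$ (trivially on the first, spinor, factor $\mathbb C^2$). Let $$\gamma^0=\begin{pmatrix}0&i\\ i&0\end{pmatrix},\quad \gamma^1=\begin{pmatrix}0&-i\\ i&0\end{pmatrix},\quad D=-i\gamma^\mu\partial_\mu\otimes 1+\gamma^0\gamma^1\otimes\mathrm{diag}(d_1,d_2),\quad \mathcal J=i\gamma^0\otimes 1,$$ with $d_1,d_2\in\mathbb R$, $d_1\neq d_2$, and $D$ densely defined on the Schwartz spinor fields. Let $\mathcal C$ be the set of Hermitian $\mathbf a\in\widetilde{\mathcal A}$ such that $\langle\phi,\mathcal J[D,\mathbf a]\phi\rangle\le 0$ for all $\phi\in\mathcal H$, where $[D,\mathbf a]$ denotes the bounded extension of the commutator. For functionals $\omega,\eta$ on $\widetilde{\mathcal A}$ write $\omega\preceq\eta$ if $\omega(\mathbf a)\le\eta(\mathbf a)$ for all $\mathbf a\in\mathcal C$. For $p\in\mathbb R^{1,1}$ and a unit vector $\xi=(\xi_1,\xi_2)\in\mathbb C^2$ let $\omega_{p,\xi}(\mathbf a)=\xi^*\mathbf a(p)\xi$. The latitude of $\xi$ is $z_\xi=|\xi_1|^2-|\xi_2|^2$,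 and $\theta_\xi$ is the argument of $\xi_1^*\xi_2$. For $\xi,\varphi$ of the same latitude, $|\theta_\varphi-\theta_\xi|\in[0,\pi]$ denotes the angle between their positions on the parallel of latitude, i.e. the absolute value of the representative of $\theta_\varphi-\theta_\xi$ modulo $2\pi$ in $(-\pi,\pi]$; it is $0$ if $\xi_1\xi_2=0$, where the parallel is a single point. **Theorem.** Let $p,q\in\mathbb R^{1,1}$ and let $\xi,\varphi\in\mathbb C^2$ be unit vectors. Then $\omega_{p,\xi}\preceq\omega_{q,\varphi}$ if and only if the following three conditions hold: 1. $p\preceq q$ in $\mathbb R^{1,1}$; 2. $\xi$ and $\varphi$ have the same latitude, $z_\xi=z_\varphi$; 3. there is a causal curve $\gamma$ from $p$ to $q$ with $l(\gamma)\ge\dfrac{|\theta_\varphi-\theta_\xi|}{|d_1-d_2|}$. -/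

import Mathlib

noncomputable section

namespace AlmostCommutative

open MeasureTheory
open scoped SchwartzMap ContDiff Kronecker ComplexConjugate ComplexOrder

/-! ## Two-dimensional Minkowski space-time -/

/-- Points (and tangent vectors) `(x⁰, x¹)` of `ℝ^{1,1}`. -/
abbrev Minkowski : Type := ℝ × ℝ

/-- The flat metric, of signature `(-, +)`. -/
def metric (v w : Minkowski) : ℝ := -(v.1 * w.1) + v.2 * w.2

/-- Future directed causal (timelike or null, hence nonzero) tangent vectors. -/
def IsFutureCausal (v : Minkowski) : Prop := metric v v ≤ 0 ∧ 0 < v.1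

/-- `γ` restricted to `[a, b]` is a piecewise `C¹` future directed causal curve. The one-point
interval `a = b` (no pieces) is allowed: this is the trivial curve at a point. -/
def IsCausalCurve (γ : ℝ → Minkowski) (a b : ℝ) : Prop :=
  ∃ (n : ℕ) (s : ℕ → ℝ), s 0 = a ∧ s n = b ∧ ∀ i < n,
    s i < s (i + 1) ∧
    ContDiffOn ℝ 1 γ (Set.Icc (s i) (s (i + 1))) ∧
    ∀ t ∈ Set.Icc (s i) (s (i + 1)),
      IsFutureCausal (derivWithin γ (Set.Icc (s i) (s (i + 1))) t)

/-- The (Lorentzian) length, i.e. the proper time, of a curve. -/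
def curveLength (γ : ℝ → Minkowski) (a b : ℝ) : ℝ :=
  ∫ t in a..b, √(-metric (deriv γ t) (deriv γ t))

/-- The causal relation `p ⪯ q` of Minkowski space-time. -/
def Precedes (p q : Minkowski) : Prop :=
  ∃ (γ : ℝ → Minkowski) (a b : ℝ), IsCausalCurve γ a b ∧ γ a = p ∧ γ b = q

/-! ## The algebras -/

/-- Smooth bounded real functions, with all derivatives bounded, which are non-decreasing along
every future directed causal curve. -/
structure IsCausalFunction (f : Minkowski → ℝ) : Prop where
  smooth : ContDiff ℝ ∞ f
  bounded : ∀ n : ℕ, ∃ C : ℝ, ∀ x, ‖iteratedFDeriv ℝ n f x‖ ≤ C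
  mono : ∀ (γ : ℝ → Minkowski) (a b : ℝ), IsCausalCurve γ a b →
    MonotoneOn (fun t => f (γ t)) (Set.Icc a b)

/-- The unitisation of the Schwartz algebra: the complex span of the causal functions. -/
def unitisationM : Submodule ℂ (Minkowski → ℂ) :=
  Submodule.span ℂ {g | ∃ f : Minkowski → ℝ, IsCausalFunction f ∧ g = fun x => (f x : ℂ)}

/-- The Schwartz functions, as a space of functions. -/
def schwartzM : Submodule ℂ (Minkowski → ℂ) where
  carrier := {g | ∃ f : 𝓢(Minkowski, ℂ), ⇑f = g}
  add_mem' := by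
    rintro _ _ ⟨f, rfl⟩ ⟨g, rfl⟩
    exact ⟨f + g, rfl⟩
  zero_mem' := ⟨0, rfl⟩
  smul_mem' := by
    rintro c _ ⟨f, rfl⟩
    exact ⟨c • f, rfl⟩

/-- The unitisation of `𝓢(ℝ^{1,1}) ⊗ M₂(ℂ)`: matrix valued functions with diagonal entries in
the span of the causal functions and with Schwartz off-diagonal entries. -/
def unitisation : Submodule ℂ (Minkowski → Matrix (Fin 2) (Fin 2) ℂ) where
  carrier := {a | (∀ i, (fun x => a x i i) ∈ unitisationM) ∧
    ∀ i j, i ≠ j → (fun x => a x i j) ∈ schwartzM}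
  add_mem' := fun ha hb =>
    ⟨fun i => unitisationM.add_mem (ha.1 i) (hb.1 i),
      fun i j h => schwartzM.add_mem (ha.2 i j h) (hb.2 i j h)⟩
  zero_mem' := ⟨fun _ => unitisationM.zero_mem, fun _ _ _ => schwartzM.zero_mem⟩
  smul_mem' := fun c _ ha =>
    ⟨fun i => unitisationM.smul_mem c (ha.1 i),
      fun i j h => schwartzM.smul_mem c (ha.2 i j h)⟩

/-! ## The Hilbert space, the fundamental symmetry and the Dirac operator -/

/-- The fibre `ℂ² ⊗ ℂ²`; the first index is the spinor index, the second one is internal. -/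
abbrev Fibre : Type := EuclideanSpace ℂ (Fin 2 × Fin 2)

/-- The Hilbert space `L²(ℝ^{1,1}) ⊗ ℂ² ⊗ ℂ²`. -/
abbrev HilbertSpace : Type := Lp Fibre 2 (volume : Measure Minkowski)

/-- The operator on the fibre given by `g ⊗ m`. -/
def fibreOp (g m : Matrix (Fin 2) (Fin 2) ℂ) : Fibre →L[ℂ] Fibre :=
  Matrix.toEuclideanCLM (n := Fin 2 × Fin 2) (𝕜 := ℂ) (g ⊗ₖ m)

/-- The flat gamma matrix `γ⁰`. -/
def gamma0 : Matrix (Fin 2) (Fin 2) ℂ := !![0, Complex.I; Complex.I, 0]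

/-- The flat gamma matrix `γ¹`. -/
def gamma1 : Matrix (Fin 2) (Fin 2) ℂ := !![0, -Complex.I; Complex.I, 0]

/-- The fundamental symmetry `𝒥 = iγ⁰ ⊗ 1`. -/
def fundamentalSymmetry : HilbertSpace →L[ℂ] HilbertSpace :=
  (fibreOp (Complex.I • gamma0) 1).compLpL 2 volume

/-- The Dirac operator `-iγ^μ∂_μ ⊗ 1 + γ⁰γ¹ ⊗ diag(d₁, d₂)` on Schwartz spinor fields. -/
def diracSchwartz (d₁ d₂ : ℝ) : 𝓢(Minkowski, Fibre) →ₗ[ℂ] 𝓢(Minkowski, Fibre) :=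
  (SchwartzMap.postcompCLM (fibreOp (-Complex.I • gamma0) 1) ∘L
      LineDeriv.lineDerivOpCLM ℂ 𝓢(Minkowski, Fibre) ((1, 0) : Minkowski) +
    SchwartzMap.postcompCLM (fibreOp (-Complex.I • gamma1) 1) ∘L
      LineDeriv.lineDerivOpCLM ℂ 𝓢(Minkowski, Fibre) ((0, 1) : Minkowski) +
    SchwartzMap.postcompCLM (fibreOp (gamma0 * gamma1) (Matrix.diagonal ![(d₁ : ℂ), (d₂ : ℂ)])) :
    𝓢(Minkowski, Fibre) →L[ℂ] 𝓢(Minkowski, Fibre)).toLinearMap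

/-- The inclusion of the Schwartz spinor fields in the Hilbert space. -/
def schwartzIncl : 𝓢(Minkowski, Fibre) →ₗ[ℂ] HilbertSpace :=
  (SchwartzMap.toLpCLM ℂ Fibre 2 (volume : Measure Minkowski)).toLinearMap

theorem schwartzIncl_injective : Function.Injective schwartzIncl :=
  SchwartzMap.injective_toLp 2 volume

/-- The Dirac operator, as an unbounded operator on the Hilbert space with dense domain
the Schwartz spinor fields. -/
def dirac (d₁ d₂ : ℝ) : HilbertSpace →ₗ.[ℂ] HilbertSpace where
  domain := LinearMap.range schwartzIncl
  toFun := schwartzIncl ∘ₗ diracSchwartz d₁ d₂ ∘ₗ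
    (LinearEquiv.ofInjective schwartzIncl schwartzIncl_injective).symm.toLinearMap

/-! ## The representation -/

theorem continuous_bounded_of_mem_unitisationM {g : Minkowski → ℂ} (hg : g ∈ unitisationM) :
    Continuous g ∧ ∃ C : ℝ, ∀ x, ‖g x‖ ≤ C := by
  induction hg using Submodule.span_induction with
  | mem g hg =>
    obtain ⟨f, hf, rfl⟩ := hg
    obtain ⟨C, hC⟩ := hf.bounded 0
    exact ⟨Complex.continuous_ofReal.comp hf.smooth.continuous, C, fun x => by simpa using hC x⟩
  | zero => exact ⟨continuous_const, 0, fun x => by simp⟩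
  | add f g _ _ hf hg =>
    obtain ⟨hf, C, hC⟩ := hf
    obtain ⟨hg, E, hE⟩ := hg
    exact ⟨hf.add hg, C + E, fun x => (norm_add_le _ _).trans (add_le_add (hC x) (hE x))⟩
  | smul c f _ hf =>
    obtain ⟨hf, C, hC⟩ := hf
    refine ⟨hf.const_smul c, ‖c‖ * C, fun x => ?_⟩
    rw [Pi.smul_apply, norm_smul]
    exact mul_le_mul_of_nonneg_left (hC x) (norm_nonneg c)

theorem continuous_bounded_of_mem_schwartzM {g : Minkowski → ℂ} (hg : g ∈ schwartzM) :
    Continuous g ∧ ∃ C : ℝ, ∀ x, ‖g x‖ ≤ C := by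
  obtain ⟨f, rfl⟩ := hg
  exact ⟨f.continuous, _, fun x => SchwartzMap.norm_le_seminorm ℝ f x⟩

theorem continuous_bounded_entry (a : unitisation) (i j : Fin 2) :
    Continuous (fun x => a.1 x i j) ∧ ∃ C : ℝ, ∀ x, ‖a.1 x i j‖ ≤ C := by
  by_cases h : i = j
  · subst h
    exact continuous_bounded_of_mem_unitisationM (a.2.1 i)
  · exact continuous_bounded_of_mem_schwartzM (a.2.2 i j h)

theorem memLp_symbol (a : unitisation) :
    MemLp (fun x => fibreOp 1 (a.1 x)) ⊤ (volume : Measure Minkowski) := by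
  let L : Matrix (Fin 2) (Fin 2) ℂ →ₗ[ℂ] (Fibre →L[ℂ] Fibre) :=
    { toFun := fibreOp 1
      map_add' := fun m n => by simp [fibreOp, Matrix.kronecker_add]
      map_smul' := fun c m => by simp [fibreOp, Matrix.kronecker_smul] }
  have key : (fun x => fibreOp 1 (a.1 x)) =
      fun x => ∑ i, ∑ j, (a.1 x i j) • fibreOp 1 (Matrix.single i j 1) := by
    funext x
    change L (a.1 x) = ∑ i, ∑ j, (a.1 x i j) • L (Matrix.single i j 1)
    conv_lhs => rw [Matrix.matrix_eq_sum_single (a.1 x)]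
    simp only [map_sum, ← map_smul, Matrix.smul_single, smul_eq_mul, mul_one]
  choose hc C hC using continuous_bounded_entry a
  refine memLp_top_of_bound (C := ∑ i, ∑ j, C i j * ‖fibreOp 1 (Matrix.single i j 1)‖) ?_
    (Filter.Eventually.of_forall fun x => ?_)
  · rw [key]
    exact (continuous_finsetSum _ fun i _ => continuous_finsetSum _ fun j _ =>
      (hc i j).smul continuous_const).aestronglyMeasurable
  · rw [congrFun key x]
    refine (norm_sum_le _ _).trans (Finset.sum_le_sum fun i _ =>
      (norm_sum_le _ _).trans (Finset.sum_le_sum fun j _ => ?_))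
    rw [norm_smul]
    exact mul_le_mul_of_nonneg_right (hC i j x) (norm_nonneg _)

/-- The representation of the unitisation by bounded operators:
`(π(a)ψ)(x) = (1 ⊗ a(x)) ψ(x)`. -/
def represent (a : unitisation) : HilbertSpace →L[ℂ] HilbertSpace :=
  (ContinuousLinearMap.id ℂ (Fibre →L[ℂ] Fibre)).holderL volume ⊤ 2 2 (memLp_symbol a).toLp

theorem coeFn_represent (a : unitisation) (ψ : HilbertSpace) :
    represent a ψ =ᵐ[volume] fun x => fibreOp 1 (a.1 x) (ψ x) := by
  have h := (ContinuousLinearMap.id ℂ (Fibre →L[ℂ] Fibre)).coeFn_holder (r := 2)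
    (memLp_symbol a).toLp ψ
  filter_upwards [h, (memLp_symbol a).coeFn_toLp] with x h1 h2
  exact h1.trans (by rw [h2]; rfl)

/-! ## The causal cone and the causal relation -/

/-- The bounded operator `B` extends the commutator `[D, a]`. -/
def ExtendsCommutator (d₁ d₂ : ℝ) (a : unitisation) (B : HilbertSpace →L[ℂ] HilbertSpace) :
    Prop :=
  ∀ ψ : (dirac d₁ d₂).domain, ∃ h : represent a ψ ∈ (dirac d₁ d₂).domain,
    B ψ = dirac d₁ d₂ ⟨represent a ψ, h⟩ - represent a (dirac d₁ d₂ ψ)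

/-- The causal cone: the Hermitian elements `a` with `⟨φ, 𝒥[D, a]φ⟩ ≤ 0` for all `φ` in the
Hilbert space, where `[D, a]` is the bounded extension of the commutator. (The order on `ℂ` is
such that `z ≤ 0` means that `z` is real and non-positive.) -/
def causalCone (d₁ d₂ : ℝ) : Set unitisation :=
  {a | (∀ x, (a.1 x).IsHermitian) ∧
    ∃ B : HilbertSpace →L[ℂ] HilbertSpace, ExtendsCommutator d₁ d₂ a B ∧
      ∀ φ : HilbertSpace, inner ℂ φ (fundamentalSymmetry (B φ)) ≤ 0}

/-- The causal relation between functionals (in particular states) on the unitisation. -/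
def CausallyPrecedes (d₁ d₂ : ℝ) (σ τ : unitisation →ₗ[ℂ] ℂ) : Prop :=
  ∀ a ∈ causalCone d₁ d₂, σ a ≤ τ a

/-! ## Pure states -/

/-- The state `ω_{p,ξ}(a) = ξ* a(p) ξ`, for a normalised vector `ξ`. -/
def pureState (p : Minkowski) (ξ : EuclideanSpace ℂ (Fin 2)) : unitisation →ₗ[ℂ] ℂ where
  toFun a := ∑ i, ∑ j, conj (ξ i) * a.1 p i j * ξ j
  map_add' a b := by
    simp [mul_add, add_mul, Finset.sum_add_distrib]
  map_smul' c a := by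
    simp only [Submodule.coe_smul, Pi.smul_apply, Matrix.smul_apply, smul_eq_mul,
      RingHom.id_apply, Finset.mul_sum]
    exact Finset.sum_congr rfl fun i _ => Finset.sum_congr rfl fun j _ => by ring

/-- The latitude `z_ξ = |ξ₁|² - |ξ₂|²` on the sphere. -/
def latitude (ξ : EuclideanSpace ℂ (Fin 2)) : ℝ := ‖ξ 0‖ ^ 2 - ‖ξ 1‖ ^ 2

/-- The position `θ_ξ` on the parallel of latitude, an angle modulo `2π`: the argument of
`ξ₁* ξ₂ = (x_ξ + i y_ξ) / 2`, hence of `ξ₂` if `ξ` is normalised so that `ξ₁ > 0`. (At the two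
poles, where the parallel is a single point, it is set to `0`.) -/
def longitude (ξ : EuclideanSpace ℂ (Fin 2)) : Real.Angle :=
  (Complex.arg (conj (ξ 0) * ξ 1) : Real.Angle)

/-- The distance `|θ_φ - θ_ξ| ∈ [0, π]` along the parallel of latitude. -/
def angularDistance (ξ φ : EuclideanSpace ℂ (Fin 2)) : ℝ :=
  |(longitude φ - longitude ξ).toReal|

end AlmostCommutative

end

/-!
Commuting a matrix-valued function with the Dirac operator gives a multiplication operator, so
membership in the causal cone is the pointwise positivity of a quadratic form in two vectors of
`ℂ²`, whose diagonal blocks are the derivatives of `a` along the two null directions and whose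
coupling is `d₁ - d₂` times the off-diagonal entry of `a`. Along a causal segment the form bounds
that entry by the growth of the expectation values, so `ω_{x,ξ}(a)` does not decrease as long as the
relative phase of `ξ` turns by at most `|d₁ - d₂|` times the proper time.

Conversely, diagonal elements recover the causal order on space-time and the latitude. For the bound
on the angle, let `T` be the proper time along a boosted axis. With diagonal entries `tan (k T)` and
off-diagonal entries `1 / cos (k T)`, for `k = |d₁ - d₂|`, the quadratic form degenerates because
`sec' ^ 2 + sec ^ 2 = tan' ^ 2`; suitably cut off, this element lies in the causal cone. A constant
diagonal matrix moves the two vectors to the equator, symmetrically about the axis on which the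
off-diagonal entries have expectation zero, where the element separates the states if the angle
exceeds the bound. Lightlike separation is a limit of timelike separation.
-/

noncomputable section

namespace AlmostCommutative

open MeasureTheory
open scoped SchwartzMap ContDiff Kronecker ComplexConjugate ComplexOrder

section BoundedDerivs

variable {E F G : Type*} [NormedAddCommGroup E] [NormedSpace ℝ E]
  [NormedAddCommGroup F] [NormedSpace ℝ F] [NormedAddCommGroup G] [NormedSpace ℝ G]

/-- Smooth functions all of whose derivatives, the function included, are bounded: the regularity
of the entries of the elements of the algebra. -/
structure HasBoundedDerivs (g : E → F) : Prop where
  smooth : ContDiff ℝ ∞ g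
  bounded : ∀ n : ℕ, ∃ C : ℝ, ∀ x, ‖iteratedFDeriv ℝ n g x‖ ≤ C

namespace HasBoundedDerivs

theorem add {f g : E → F} (hf : HasBoundedDerivs f) (hg : HasBoundedDerivs g) :
    HasBoundedDerivs (fun x => f x + g x) := by
  refine ⟨hf.smooth.add hg.smooth, fun n => ?_⟩
  obtain ⟨C, hC⟩ := hf.bounded n
  obtain ⟨K, hK⟩ := hg.bounded n
  refine ⟨C + K, fun x => ?_⟩
  have hadd : iteratedFDeriv ℝ n (fun x => f x + g x) x =
      iteratedFDeriv ℝ n f x + iteratedFDeriv ℝ n g x :=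
    iteratedFDeriv_add_apply (hf.smooth.of_le (mod_cast le_top)).contDiffAt
      (hg.smooth.of_le (mod_cast le_top)).contDiffAt
  rw [hadd]
  exact (norm_add_le _ _).trans (add_le_add (hC x) (hK x))

theorem clm_comp {f : E → F} (hf : HasBoundedDerivs f) (L : F →L[ℝ] G) :
    HasBoundedDerivs (fun x => L (f x)) := by
  refine ⟨L.contDiff.comp hf.smooth, fun n => ?_⟩
  obtain ⟨C, hC⟩ := hf.bounded n
  refine ⟨‖L‖ * C, fun x => ?_⟩
  refine (L.norm_iteratedFDeriv_comp_left hf.smooth.contDiffAt (mod_cast le_top)).trans ?_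
  exact mul_le_mul_of_nonneg_left (hC x) (norm_nonneg L)

theorem comp_clm {f : E → F} (hf : HasBoundedDerivs f) (L : G →L[ℝ] E) :
    HasBoundedDerivs (fun x => f (L x)) := by
  refine ⟨hf.smooth.comp L.contDiff, fun n => ?_⟩
  obtain ⟨C, hC⟩ := hf.bounded n
  refine ⟨C * ∏ _i : Fin n, ‖L‖, fun x => ?_⟩
  have hcomp : iteratedFDeriv ℝ n (fun x => f (L x)) x =
      (iteratedFDeriv ℝ n f (L x)).compContinuousLinearMap fun _ => L :=
    L.iteratedFDeriv_comp_right hf.smooth x (mod_cast le_top)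
  rw [hcomp]
  refine (ContinuousMultilinearMap.norm_compContinuousLinearMap_le _ _).trans ?_
  exact mul_le_mul_of_nonneg_right (hC _) (Finset.prod_nonneg fun _ _ => norm_nonneg _)

theorem fderiv_apply {f : E → F} (hf : HasBoundedDerivs f) (e : E) :
    HasBoundedDerivs (fun x => fderiv ℝ f x e) := by
  have hfderiv : HasBoundedDerivs (fderiv ℝ f) := by
    refine ⟨hf.smooth.fderiv_right (by simp), fun n => ?_⟩
    simpa only [norm_iteratedFDeriv_fderiv] using hf.bounded (n + 1)
  exact hfderiv.clm_comp (ContinuousLinearMap.apply ℝ F e)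

theorem differentiable {f : E → F} (hf : HasBoundedDerivs f) : Differentiable ℝ f :=
  hf.smooth.differentiable (by simp)

theorem hasTemperateGrowth {f : E → F} (hf : HasBoundedDerivs f) : f.HasTemperateGrowth :=
  ⟨hf.smooth, fun n => (hf.bounded n).elim fun C hC => ⟨0, C, fun x => by simpa using hC x⟩⟩

theorem memLp_top [MeasurableSpace E] [OpensMeasurableSpace E] [SecondCountableTopologyEither E F]
    {f : E → F} (hf : HasBoundedDerivs f) (μ : Measure E) : MemLp f ⊤ μ := by
  obtain ⟨C, hC⟩ := hf.bounded 0
  exact memLp_top_of_bound hf.smooth.continuous.aestronglyMeasurable C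
    (Filter.Eventually.of_forall fun x => by simpa using hC x)

end HasBoundedDerivs

theorem hasBoundedDerivs_const (c : F) : HasBoundedDerivs (fun _ : E => c) := by
  refine ⟨contDiff_const, fun n => ?_⟩
  rcases n with _ | n
  · exact ⟨‖c‖, fun x => by simp⟩
  · refine ⟨0, fun x => ?_⟩
    rw [iteratedFDeriv_const_of_ne (Nat.succ_ne_zero n)]
    simp

theorem hasBoundedDerivs_schwartzMap (f : 𝓢(E, F)) : HasBoundedDerivs f := by
  refine ⟨f.smooth', fun n => ?_⟩
  obtain ⟨C, hC⟩ := f.decay' 0 n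
  simp only [pow_zero, one_mul] at hC
  exact ⟨C, hC⟩

theorem hasBoundedDerivs_of_hasCompactSupport_deriv {f : ℝ → F} (hf : ContDiff ℝ ∞ f) {C : ℝ}
    (hC : ∀ x, ‖f x‖ ≤ C) (h : HasCompactSupport (deriv f)) : HasBoundedDerivs f := by
  refine ⟨hf, fun n => ?_⟩
  rcases n with _ | n
  · exact ⟨C, fun x => by simpa using hC x⟩
  · have hd : ContDiff ℝ ∞ (deriv f) := (contDiff_infty_iff_deriv.1 hf).2
    obtain ⟨K, hK⟩ := (hasBoundedDerivs_schwartzMap (h.toSchwartzMap hd)).bounded n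
    refine ⟨K, fun x => ?_⟩
    rw [norm_iteratedFDeriv_eq_norm_iteratedDeriv, iteratedDeriv_succ',
      ← norm_iteratedFDeriv_eq_norm_iteratedDeriv]
    exact hK x

end BoundedDerivs

theorem IsCausalFunction.hasBoundedDerivs {f : Minkowski → ℝ} (hf : IsCausalFunction f) :
    HasBoundedDerivs f := ⟨hf.smooth, hf.bounded⟩

theorem hasBoundedDerivs_of_mem_unitisationM {g : Minkowski → ℂ} (hg : g ∈ unitisationM) :
    HasBoundedDerivs g := by
  induction hg using Submodule.span_induction with
  | mem g hg =>
    obtain ⟨f, hf, rfl⟩ := hg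
    exact hf.hasBoundedDerivs.clm_comp Complex.ofRealCLM
  | zero => exact hasBoundedDerivs_const 0
  | add f g _ _ hf hg => exact hf.add hg
  | smul c f _ hf =>
    exact hf.clm_comp ((ContinuousLinearMap.lsmul ℂ ℂ c).restrictScalars ℝ)

theorem hasBoundedDerivs_entry (a : unitisation) (i j : Fin 2) :
    HasBoundedDerivs (fun x => a.1 x i j) := by
  by_cases h : i = j
  · subst h
    exact hasBoundedDerivs_of_mem_unitisationM (a.2.1 i)
  · obtain ⟨f, hf⟩ := a.2.2 i j h
    rw [← hf]
    exact hasBoundedDerivs_schwartzMap f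

/-! ## The commutator -/

section FibreOp

variable (g : Matrix (Fin 2) (Fin 2) ℂ)

theorem fibreOp_add (m n : Matrix (Fin 2) (Fin 2) ℂ) :
    fibreOp g (m + n) = fibreOp g m + fibreOp g n := by
  simp [fibreOp, Matrix.kronecker_add]

theorem fibreOp_smul (c : ℂ) (m : Matrix (Fin 2) (Fin 2) ℂ) :
    fibreOp g (c • m) = c • fibreOp g m := by
  simp [fibreOp, Matrix.kronecker_smul]

theorem fibreOp_sub (m n : Matrix (Fin 2) (Fin 2) ℂ) :
    fibreOp g (m - n) = fibreOp g m - fibreOp g n := by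
  rw [eq_sub_iff_add_eq, ← fibreOp_add, sub_add_cancel]

theorem fibreOp_eq_sum_single (m : Matrix (Fin 2) (Fin 2) ℂ) :
    fibreOp g m = ∑ i, ∑ j, m i j • fibreOp g (Matrix.single i j 1) := by
  let L : Matrix (Fin 2) (Fin 2) ℂ →ₗ[ℂ] (Fibre →L[ℂ] Fibre) :=
    { toFun := fibreOp g
      map_add' := fibreOp_add g
      map_smul' := fibreOp_smul g }
  change L m = ∑ i, ∑ j, m i j • L (Matrix.single i j 1)
  conv_lhs => rw [Matrix.matrix_eq_sum_single m]
  simp only [map_sum, ← map_smul, Matrix.smul_single, smul_eq_mul, mul_one]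

theorem fibreOp_apply_fibreOp (h m n : Matrix (Fin 2) (Fin 2) ℂ) (v : Fibre) :
    fibreOp g m (fibreOp h n v) = fibreOp (g * h) (m * n) v := by
  simp only [fibreOp, Matrix.mul_kronecker_mul, map_mul]
  rfl

variable {E : Type*} [NormedAddCommGroup E] [NormedSpace ℝ E]
  {b : E → Matrix (Fin 2) (Fin 2) ℂ}

theorem hasBoundedDerivs_fibreOp (hb : ∀ i j, HasBoundedDerivs fun x => b x i j) :
    HasBoundedDerivs fun x => fibreOp g (b x) := by
  have hij (i j : Fin 2) :
      HasBoundedDerivs fun x => b x i j • fibreOp g (Matrix.single i j 1) :=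
    (hb i j).clm_comp
      ((ContinuousLinearMap.toSpanSingleton ℂ (fibreOp g (Matrix.single i j 1))).restrictScalars ℝ)
  simp only [fibreOp_eq_sum_single g (b _), Fin.sum_univ_two]
  exact ((hij 0 0).add (hij 0 1)).add ((hij 1 0).add (hij 1 1))

theorem fderiv_fibreOp {x : E} (hb : ∀ i j, DifferentiableAt ℝ (fun y => b y i j) x) (e : E) :
    fderiv ℝ (fun y => fibreOp g (b y)) x e =
      fibreOp g (Matrix.of fun i j => fderiv ℝ (fun y => b y i j) x e) := by
  have hij (i j : Fin 2) :
      HasFDerivAt (fun y => b y i j • fibreOp g (Matrix.single i j 1)) _ x :=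
    (hb i j).hasFDerivAt.smul_const (fibreOp g (Matrix.single i j 1))
  simp only [fibreOp_eq_sum_single g (b _)]
  rw [(HasFDerivAt.fun_sum fun i _ => HasFDerivAt.fun_sum fun j _ => hij i j).fderiv,
    fibreOp_eq_sum_single]
  simp

end FibreOp

section Commutator

variable (d₁ d₂ : ℝ) (a : unitisation)

/-- The entrywise derivative of `a` at `x` in the direction `e`. -/
def entryDeriv (e x : Minkowski) : Matrix (Fin 2) (Fin 2) ℂ :=
  Matrix.of fun i j => fderiv ℝ (fun y => a.1 y i j) x e

/-- The matrix-valued function by which the commutator `[D, a]` multiplies. -/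
def commutatorSymbol (x : Minkowski) : Fibre →L[ℂ] Fibre :=
  fibreOp (-Complex.I • gamma0) (entryDeriv a (1, 0) x) +
    fibreOp (-Complex.I • gamma1) (entryDeriv a (0, 1) x) +
    fibreOp (gamma0 * gamma1) (Matrix.diagonal ![(d₁ : ℂ), (d₂ : ℂ)] * a.1 x -
      a.1 x * Matrix.diagonal ![(d₁ : ℂ), (d₂ : ℂ)])

theorem hasBoundedDerivs_commutatorSymbol : HasBoundedDerivs (commutatorSymbol d₁ d₂ a) := by
  have hderiv (g : Matrix (Fin 2) (Fin 2) ℂ) (e : Minkowski) :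
      HasBoundedDerivs fun x => fibreOp g (entryDeriv a e x) :=
    hasBoundedDerivs_fibreOp g fun i j => (hasBoundedDerivs_entry a i j).fderiv_apply e
  refine ((hderiv _ _).add (hderiv _ _)).add (hasBoundedDerivs_fibreOp _ fun i j => ?_)
  have hij : HasBoundedDerivs fun x =>
      (![(d₁ : ℂ), (d₂ : ℂ)] i - ![(d₁ : ℂ), (d₂ : ℂ)] j) * a.1 x i j :=
    (hasBoundedDerivs_entry a i j).clm_comp
      ((ContinuousLinearMap.mul ℂ ℂ _).restrictScalars ℝ)
  simpa only [Matrix.sub_apply, Matrix.diagonal_mul, Matrix.mul_diagonal, sub_mul,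
    mul_comm (a.1 _ i j)] using hij

/-- Multiplication of Schwartz spinor fields by `a`. -/
def schwartzMul : 𝓢(Minkowski, Fibre) →L[ℂ] 𝓢(Minkowski, Fibre) :=
  SchwartzMap.bilinLeftCLM (ContinuousLinearMap.id ℂ (Fibre →L[ℂ] Fibre)).flip
    (hasBoundedDerivs_fibreOp 1 (hasBoundedDerivs_entry a)).hasTemperateGrowth

theorem schwartzMul_apply (ψ : 𝓢(Minkowski, Fibre)) (x : Minkowski) :
    schwartzMul a ψ x = fibreOp 1 (a.1 x) (ψ x) := rfl

theorem coeFn_schwartzIncl (ψ : 𝓢(Minkowski, Fibre)) : schwartzIncl ψ =ᵐ[volume] ψ :=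
  ψ.coeFn_toLp 2 volume

theorem represent_schwartzIncl (ψ : 𝓢(Minkowski, Fibre)) :
    represent a (schwartzIncl ψ) = schwartzIncl (schwartzMul a ψ) := by
  refine Lp.ext ?_
  filter_upwards [coeFn_represent a (schwartzIncl ψ), coeFn_schwartzIncl ψ,
    coeFn_schwartzIncl (schwartzMul a ψ)] with x hrep hψ hmul
  rw [hrep, hψ, hmul, schwartzMul_apply]

theorem fderiv_schwartzMul (ψ : 𝓢(Minkowski, Fibre)) (x e : Minkowski) :
    fderiv ℝ (schwartzMul a ψ) x e =
      fibreOp 1 (entryDeriv a e x) (ψ x) + fibreOp 1 (a.1 x) (fderiv ℝ ψ x e) := by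
  let evalBilin : (Fibre →L[ℂ] Fibre) →L[ℝ] Fibre →L[ℝ] Fibre :=
    (ContinuousLinearMap.id ℂ (Fibre →L[ℂ] Fibre)).bilinearRestrictScalars ℝ
  have hsymbol :=
    ((hasBoundedDerivs_fibreOp 1 (hasBoundedDerivs_entry a)).differentiable x).hasFDerivAt
  have hmul : HasFDerivAt (schwartzMul a ψ) _ x :=
    evalBilin.hasFDerivAt_of_bilinear hsymbol (ψ.hasFDerivAt x)
  rw [hmul.fderiv, add_comm, entryDeriv,
    ← fderiv_fibreOp 1 (fun i j => (hasBoundedDerivs_entry a i j).differentiable x)]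
  rfl

theorem diracSchwartz_apply (ψ : 𝓢(Minkowski, Fibre)) (x : Minkowski) :
    diracSchwartz d₁ d₂ ψ x =
      fibreOp (-Complex.I • gamma0) 1 (fderiv ℝ ψ x (1, 0)) +
        fibreOp (-Complex.I • gamma1) 1 (fderiv ℝ ψ x (0, 1)) +
        fibreOp (gamma0 * gamma1) (Matrix.diagonal ![(d₁ : ℂ), (d₂ : ℂ)]) (ψ x) := rfl

theorem diracSchwartz_commutator (ψ : 𝓢(Minkowski, Fibre)) (x : Minkowski) :
    (diracSchwartz d₁ d₂ (schwartzMul a ψ) - schwartzMul a (diracSchwartz d₁ d₂ ψ)) x =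
      commutatorSymbol d₁ d₂ a x (ψ x) := by
  rw [sub_apply, schwartzMul_apply, diracSchwartz_apply, diracSchwartz_apply,
    fderiv_schwartzMul, fderiv_schwartzMul, schwartzMul_apply, commutatorSymbol]
  simp only [map_add, fibreOp_apply_fibreOp, mul_one, one_mul, fibreOp_sub,
    add_apply, sub_apply]
  abel

/-- The bounded extension of the commutator `[D, a]`. -/
def commutatorOp : HilbertSpace →L[ℂ] HilbertSpace :=
  (ContinuousLinearMap.id ℂ (Fibre →L[ℂ] Fibre)).holderL volume ⊤ 2 2
    ((hasBoundedDerivs_commutatorSymbol d₁ d₂ a).memLp_top volume).toLp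

theorem coeFn_commutatorOp (φ : HilbertSpace) :
    commutatorOp d₁ d₂ a φ =ᵐ[volume] fun x => commutatorSymbol d₁ d₂ a x (φ x) := by
  have hS := (hasBoundedDerivs_commutatorSymbol d₁ d₂ a).memLp_top volume
  filter_upwards [(ContinuousLinearMap.id ℂ (Fibre →L[ℂ] Fibre)).coeFn_holder (r := 2) hS.toLp φ,
    hS.coeFn_toLp] with x hholder hsymbol
  exact hholder.trans (by rw [hsymbol]; rfl)

theorem commutatorOp_schwartzIncl (ψ : 𝓢(Minkowski, Fibre)) :
    commutatorOp d₁ d₂ a (schwartzIncl ψ) = schwartzIncl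
      (diracSchwartz d₁ d₂ (schwartzMul a ψ) - schwartzMul a (diracSchwartz d₁ d₂ ψ)) := by
  refine Lp.ext ?_
  filter_upwards [coeFn_commutatorOp d₁ d₂ a (schwartzIncl ψ), coeFn_schwartzIncl ψ,
    coeFn_schwartzIncl (diracSchwartz d₁ d₂ (schwartzMul a ψ) -
      schwartzMul a (diracSchwartz d₁ d₂ ψ))] with x hop hψ hcomm
  rw [hop, hψ, hcomm, diracSchwartz_commutator]

theorem dirac_schwartzIncl (ψ : 𝓢(Minkowski, Fibre))
    (h : schwartzIncl ψ ∈ (dirac d₁ d₂).domain) :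
    dirac d₁ d₂ ⟨schwartzIncl ψ, h⟩ = schwartzIncl (diracSchwartz d₁ d₂ ψ) :=
  congrArg (fun χ => schwartzIncl (diracSchwartz d₁ d₂ χ))
    ((LinearEquiv.symm_apply_eq _).2 (Subtype.ext rfl))

theorem denseRange_schwartzIncl : DenseRange schwartzIncl :=
  SchwartzMap.denseRange_toLpCLM (F := Fibre) (μ := (volume : Measure Minkowski))
    ENNReal.ofNat_ne_top

variable {d₁ d₂ a}

theorem extendsCommutator_iff {B : HilbertSpace →L[ℂ] HilbertSpace} :
    ExtendsCommutator d₁ d₂ a B ↔ B = commutatorOp d₁ d₂ a := by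
  have hdom (ψ : 𝓢(Minkowski, Fibre)) : schwartzIncl ψ ∈ (dirac d₁ d₂).domain := ⟨ψ, rfl⟩
  constructor
  · intro h
    refine DFunLike.ext' (denseRange_schwartzIncl.equalizer B.continuous
      (commutatorOp d₁ d₂ a).continuous (funext fun ψ => ?_))
    obtain ⟨_, hB⟩ := h ⟨schwartzIncl ψ, hdom ψ⟩
    rw [Function.comp_apply, Function.comp_apply, hB, commutatorOp_schwartzIncl]
    simp only [represent_schwartzIncl, dirac_schwartzIncl, map_sub]
  · rintro rfl χ
    obtain ⟨ψ, hψ⟩ : ∃ ψ, schwartzIncl ψ = χ := χ.2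
    obtain rfl : χ = ⟨schwartzIncl ψ, hdom ψ⟩ := Subtype.ext hψ.symm
    refine ⟨by rw [represent_schwartzIncl]; exact hdom _, ?_⟩
    simp only [represent_schwartzIncl, dirac_schwartzIncl, commutatorOp_schwartzIncl, map_sub]

end Commutator

/-! ## The pointwise description of the causal cone -/

section Expectation

/-- The expectation value `z* b z`, meant for Hermitian `b`; the real part is then the whole. -/
def expectation (z : Fin 2 → ℂ) (b : Matrix (Fin 2) (Fin 2) ℂ) : ℝ :=
  (∑ i, ∑ j, conj (z i) * b i j * z j).re

variable (z : Fin 2 → ℂ) {b : Matrix (Fin 2) (Fin 2) ℂ}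

theorem expectation_add (b c : Matrix (Fin 2) (Fin 2) ℂ) :
    expectation z (b + c) = expectation z b + expectation z c := by
  simp only [expectation, Matrix.add_apply, mul_add, add_mul, Finset.sum_add_distrib,
    Complex.add_re]

theorem expectation_smul (c : ℝ) (b : Matrix (Fin 2) (Fin 2) ℂ) :
    expectation z (c • b) = c * expectation z b := by
  simp only [expectation, Matrix.smul_apply, mul_smul_comm, smul_mul_assoc, ← Finset.smul_sum,
    Complex.smul_re, smul_eq_mul]

theorem expectation_smul_vec (c : ℂ) (b : Matrix (Fin 2) (Fin 2) ℂ) :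
    expectation (c • z) b = ‖c‖ ^ 2 * expectation z b := by
  rw [expectation, expectation, ← Complex.re_ofReal_mul, Finset.mul_sum]
  congr 1
  refine Finset.sum_congr rfl fun i _ => ?_
  rw [Finset.mul_sum]
  refine Finset.sum_congr rfl fun j _ => ?_
  rw [Complex.ofReal_pow, ← Complex.conj_mul' c, Pi.smul_apply, Pi.smul_apply, smul_eq_mul,
    smul_eq_mul, map_mul]
  ring

theorem sum_conj_mul_mul_eq_expectation (hb : b.IsHermitian) :
    ∑ i, ∑ j, conj (z i) * b i j * z j = expectation z b := by
  refine Complex.ext (by simp [expectation]) ?_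
  have h10 : b 1 0 = conj (b 0 1) := (hb.apply 1 0).symm
  have h00 : (b 0 0).im = 0 := Complex.conj_eq_iff_im.1 (hb.apply 0 0)
  have h11 : (b 1 1).im = 0 := Complex.conj_eq_iff_im.1 (hb.apply 1 1)
  simp only [Fin.sum_univ_two, h10, Complex.add_im, Complex.mul_re, Complex.mul_im,
    Complex.conj_re, Complex.conj_im, h00, h11, Complex.ofReal_im]
  ring

theorem expectation_of_isHermitian (hb : b.IsHermitian) :
    expectation z b =
      ‖z 0‖ ^ 2 * (b 0 0).re + ‖z 1‖ ^ 2 * (b 1 1).re + 2 * (conj (z 0) * z 1 * b 0 1).re := by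
  have h10 : b 1 0 = conj (b 0 1) := (hb.apply 1 0).symm
  rw [expectation, ← Complex.normSq_eq_norm_sq, ← Complex.normSq_eq_norm_sq]
  simp only [Fin.sum_univ_two, h10, Complex.normSq_apply, Complex.add_re, Complex.mul_re,
    Complex.mul_im, Complex.conj_re, Complex.conj_im]
  ring

end Expectation

theorem isHermitian_entryDeriv {a : unitisation} (ha : ∀ x, (a.1 x).IsHermitian)
    (e x : Minkowski) : (entryDeriv a e x).IsHermitian := by
  ext i j
  have hij : (fun y => a.1 y i j) = fun y => star (a.1 y j i) :=
    funext fun y => ((ha y).apply i j).symm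
  simp only [Matrix.conjTranspose_apply, entryDeriv, Matrix.of_apply]
  rw [hij, fderiv_star]
  rfl

theorem entryDeriv_add (a : unitisation) (e f x : Minkowski) :
    entryDeriv a (e + f) x = entryDeriv a e x + entryDeriv a f x := by
  ext i j
  simp [entryDeriv]

theorem entryDeriv_smul (a : unitisation) (c : ℝ) (e x : Minkowski) :
    entryDeriv a (c • e) x = c • entryDeriv a e x := by
  ext i j
  simp [entryDeriv]

theorem continuous_expectation_entryDeriv (a : unitisation) (z : Fin 2 → ℂ) (e : Minkowski) :
    Continuous fun x => expectation z (entryDeriv a e x) := by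
  have hij (i j : Fin 2) : Continuous fun x => entryDeriv a e x i j :=
    ((hasBoundedDerivs_entry a i j).fderiv_apply e).smooth.continuous
  exact Complex.continuous_re.comp (continuous_finsetSum _ fun i _ => continuous_finsetSum _
    fun j _ => (continuous_const.mul (hij i j)).mul continuous_const)

section CausalForm

variable (d₁ d₂ : ℝ) (a : unitisation) (x : Minkowski) (y z : Fin 2 → ℂ)

/-- The quadratic form of `-𝒥[D, a]` at the point `x`, for Hermitian `a`, on the fibre vector with
spinor components `y` and `z`. The two spinor components see the derivatives of `a` in the two null
directions. -/
def causalForm : ℝ :=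
  expectation y (entryDeriv a (1, 1) x) + expectation z (entryDeriv a (1, -1) x) +
    2 * (d₁ - d₂) * (a.1 x 0 1 * (conj (y 0) * z 1 - conj (z 0) * y 1)).re

theorem causalForm_smul (c : ℂ) :
    causalForm d₁ d₂ a x (c • y) (c • z) = ‖c‖ ^ 2 * causalForm d₁ d₂ a x y z := by
  have hcross : a.1 x 0 1 * (conj ((c • y) 0) * (c • z) 1 - conj ((c • z) 0) * (c • y) 1) =
      (‖c‖ ^ 2 : ℝ) * (a.1 x 0 1 * (conj (y 0) * z 1 - conj (z 0) * y 1)) := by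
    simp only [Pi.smul_apply, smul_eq_mul, map_mul, Complex.ofReal_pow, ← Complex.conj_mul' c]
    ring
  rw [causalForm, causalForm, expectation_smul_vec, expectation_smul_vec, hcross,
    Complex.re_ofReal_mul]
  ring

theorem continuous_causalForm : Continuous fun x => causalForm d₁ d₂ a x y z :=
  ((continuous_expectation_entryDeriv a y _).add (continuous_expectation_entryDeriv a z _)).add
    (continuous_const.mul (Complex.continuous_re.comp
      ((hasBoundedDerivs_entry a 0 1).smooth.continuous.mul continuous_const)))

theorem fibreOp_apply (g m : Matrix (Fin 2) (Fin 2) ℂ) (v : Fibre) (i : Fin 2 × Fin 2) :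
    fibreOp g m v i = ∑ k, ∑ l, g i.1 k * m i.2 l * v (k, l) := by
  change Matrix.mulVec (g ⊗ₖ m) _ i = _
  simp [Matrix.mulVec, dotProduct, Fintype.sum_prod_type, Matrix.kroneckerMap_apply]

theorem inner_commutatorSymbol (v : Fibre) :
    inner ℂ v (fibreOp (Complex.I • gamma0) 1 (commutatorSymbol d₁ d₂ a x v)) =
      -((∑ i, ∑ j, conj (v (0, i)) * entryDeriv a (1, 1) x i j * v (0, j)) +
        (∑ i, ∑ j, conj (v (1, i)) * entryDeriv a (1, -1) x i j * v (1, j)) +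
        (d₁ - d₂) * (a.1 x 0 1 * (conj (v (0, 0)) * v (1, 1) - conj (v (1, 0)) * v (0, 1)) -
          a.1 x 1 0 * (conj (v (0, 1)) * v (1, 0) - conj (v (1, 1)) * v (0, 0)))) := by
  have hadv : ((1, 1) : Minkowski) = (1, 0) + (0, 1) := by simp
  have hret : ((1, -1) : Minkowski) = (1, 0) + (-1 : ℝ) • (0, 1) := by simp
  rw [hadv, hret, PiLp.inner_apply]
  simp only [entryDeriv_add, entryDeriv_smul, Matrix.add_apply, Matrix.smul_apply,
    commutatorSymbol, add_apply, map_add, fibreOp_apply_fibreOp, PiLp.add_apply,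
    fibreOp_apply, Fintype.sum_prod_type, Fin.sum_univ_two, RCLike.inner_apply]
  simp [gamma0, gamma1, Matrix.mul_apply, Fin.sum_univ_two, Matrix.diagonal]
  ring

variable {a}

theorem inner_commutatorSymbol_eq_causalForm (ha : ∀ x, (a.1 x).IsHermitian) (v : Fibre) :
    inner ℂ v (fibreOp (Complex.I • gamma0) 1 (commutatorSymbol d₁ d₂ a x v)) =
      ((-causalForm d₁ d₂ a x (fun i => v (0, i)) fun i => v (1, i) : ℝ) : ℂ) := by
  have h10 : a.1 x 1 0 = conj (a.1 x 0 1) := ((ha x).apply 1 0).symm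
  set c := conj (v (0, 0)) * v (1, 1) - conj (v (1, 0)) * v (0, 1) with hc
  have hconj : conj (v (0, 1)) * v (1, 0) - conj (v (1, 1)) * v (0, 0) = -conj c := by
    simp only [hc, map_sub, map_mul, Complex.conj_conj]
    ring
  have hre : a.1 x 0 1 * c - conj (a.1 x 0 1) * -conj c = ((2 * (a.1 x 0 1 * c).re : ℝ) : ℂ) := by
    rw [← Complex.add_conj, map_mul]
    ring
  rw [inner_commutatorSymbol, ← hc, h10, hconj, hre,
    sum_conj_mul_mul_eq_expectation (fun i => v (0, i)) (isHermitian_entryDeriv ha _ x),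
    sum_conj_mul_mul_eq_expectation (fun i => v (1, i)) (isHermitian_entryDeriv ha _ x),
    causalForm, ← hc]
  push_cast
  ring

theorem inner_commutatorOp (ha : ∀ x, (a.1 x).IsHermitian) (φ : HilbertSpace) :
    inner ℂ φ (fundamentalSymmetry (commutatorOp d₁ d₂ a φ)) =
      ((-∫ x, causalForm d₁ d₂ a x (fun i => φ x (0, i)) fun i => φ x (1, i) : ℝ) : ℂ) := by
  rw [L2.inner_def, ← integral_neg, ← integral_complex_ofReal]
  refine integral_congr_ae ?_
  filter_upwards [(fibreOp (Complex.I • gamma0) 1).coeFn_compLpL (p := 2)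
    (commutatorOp d₁ d₂ a φ), coeFn_commutatorOp d₁ d₂ a φ] with x hsymm hop
  rw [← inner_commutatorSymbol_eq_causalForm d₁ d₂ x ha, ← hop]
  exact congrArg _ hsymm

end CausalForm

theorem nonneg_of_forall_integral_sq_mul_nonneg {E : Type*} [NormedAddCommGroup E]
    [NormedSpace ℝ E] [FiniteDimensional ℝ E] [MeasurableSpace E] [BorelSpace E] {μ : Measure E}
    [IsLocallyFiniteMeasure μ] [μ.IsOpenPosMeasure] {F : E → ℝ} (hF : Continuous F)
    (h : ∀ f : E → ℝ, ContDiff ℝ ∞ f → HasCompactSupport f → 0 ≤ ∫ x, f x ^ 2 * F x ∂μ) (x : E) :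
    0 ≤ F x := by
  by_contra! hneg
  obtain ⟨ε, hε, hball⟩ := Metric.isOpen_iff.1 (isOpen_lt hF continuous_const) x hneg
  let f : ContDiffBump x := ⟨ε / 2, ε, half_pos hε, half_lt_self hε⟩
  have hcont : Continuous fun y => -(f y ^ 2 * F y) := ((f.continuous.pow 2).mul hF).neg
  have hsupp : HasCompactSupport fun y => -(f y ^ 2 * F y) :=
    f.hasCompactSupport.mono fun y hy hfy => hy (by simp only [hfy]; ring)
  have hpos : 0 < ∫ y, -(f y ^ 2 * F y) ∂μ := by
    refine hcont.integral_pos_of_hasCompactSupport_nonneg_nonzero hsupp (fun y => ?_) (x := x) ?_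
    · by_cases hy : y ∈ Metric.ball x ε
      · exact neg_nonneg.2 (mul_nonpos_of_nonneg_of_nonpos (sq_nonneg _) (hball hy).le)
      · have hfy : f y = 0 := f.zero_of_le_dist (by simpa using hy)
        simp [hfy]
    · have hfx : f x = 1 := f.one_of_mem_closedBall (Metric.mem_closedBall_self (half_pos hε).le)
      simpa [hfx] using hneg.ne
  rw [integral_neg] at hpos
  linarith [h f f.contDiff f.hasCompactSupport]

theorem mem_causalCone_iff {d₁ d₂ : ℝ} {a : unitisation} :
    a ∈ causalCone d₁ d₂ ↔
      (∀ x, (a.1 x).IsHermitian) ∧ ∀ x y z, 0 ≤ causalForm d₁ d₂ a x y z := by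
  constructor
  · rintro ⟨ha, B, hB, hneg⟩
    obtain rfl := extendsCommutator_iff.1 hB
    refine ⟨ha, fun x y z => nonneg_of_forall_integral_sq_mul_nonneg (μ := volume)
      (continuous_causalForm d₁ d₂ a y z) (fun f hf hsupp => ?_) x⟩
    let v : Fibre := WithLp.toLp 2 fun i => ![y i.2, z i.2] i.1
    have hsupp' : HasCompactSupport fun x => (f x : ℂ) • v :=
      hsupp.mono fun x hx hfx => hx (by simp only [hfx, Complex.ofReal_zero, zero_smul])
    let ψ : 𝓢(Minkowski, Fibre) := hsupp'.toSchwartzMap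
      ((Complex.ofRealCLM.contDiff.comp hf).smul contDiff_const)
    have hle := hneg (schwartzIncl ψ)
    rw [inner_commutatorOp d₁ d₂ ha, Complex.ofReal_neg, neg_nonpos, Complex.zero_le_real] at hle
    refine hle.trans_eq (integral_congr_ae ?_)
    filter_upwards [coeFn_schwartzIncl ψ] with x hx
    rw [hx, ← sq_abs, ← Real.norm_eq_abs, ← Complex.norm_real, ← causalForm_smul]
    rfl
  · rintro ⟨ha, hform⟩
    refine ⟨ha, commutatorOp d₁ d₂ a, extendsCommutator_iff.2 rfl, fun φ => ?_⟩
    rw [inner_commutatorOp d₁ d₂ ha, Complex.ofReal_neg, neg_nonpos, Complex.zero_le_real]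
    exact integral_nonneg fun x => hform x _ _

theorem pureState_le_iff {a : unitisation} (ha : ∀ x, (a.1 x).IsHermitian) {p q : Minkowski}
    {ξ φ : EuclideanSpace ℂ (Fin 2)} :
    pureState p ξ a ≤ pureState q φ a ↔ expectation ξ (a.1 p) ≤ expectation φ (a.1 q) := by
  have hstate (p : Minkowski) (ξ : EuclideanSpace ℂ (Fin 2)) :
      pureState p ξ a = (expectation ξ (a.1 p) : ℂ) :=
    sum_conj_mul_mul_eq_expectation ξ (ha p)
  rw [hstate, hstate, Complex.real_le_real]

/-! ## Causal curves and proper time -/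

/-- The null coordinate `x⁰ + x¹`. -/
def advancedTime : Minkowski →L[ℝ] ℝ :=
  ContinuousLinearMap.fst ℝ ℝ ℝ + ContinuousLinearMap.snd ℝ ℝ ℝ

/-- The null coordinate `x⁰ - x¹`. -/
def retardedTime : Minkowski →L[ℝ] ℝ :=
  ContinuousLinearMap.fst ℝ ℝ ℝ - ContinuousLinearMap.snd ℝ ℝ ℝ

@[simp]
theorem advancedTime_apply (v : Minkowski) : advancedTime v = v.1 + v.2 := rfl

@[simp]
theorem retardedTime_apply (v : Minkowski) : retardedTime v = v.1 - v.2 := rfl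

theorem neg_metric_self (v : Minkowski) : -metric v v = advancedTime v * retardedTime v := by
  rw [metric, advancedTime_apply, retardedTime_apply]
  ring

theorem isFutureCausal_iff {v : Minkowski} :
    IsFutureCausal v ↔ 0 ≤ advancedTime v ∧ 0 ≤ retardedTime v ∧ v ≠ 0 := by
  simp only [advancedTime_apply, retardedTime_apply]
  constructor
  · rintro ⟨h, h0⟩
    rw [metric] at h
    have := abs_le_of_sq_le_sq' (a := v.2) (b := v.1) (by nlinarith) h0.le
    exact ⟨by linarith, by linarith, fun hv => by simp [hv] at h0⟩
  · rintro ⟨hadv, hret, hv⟩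
    refine ⟨by rw [metric]; nlinarith, ?_⟩
    by_contra! h
    exact hv (Prod.ext (show v.1 = 0 by linarith) (show v.2 = 0 by linarith))

/-- The time coordinate of the inertial frame in which the null coordinates are `β (x⁰ + x¹)` and
`β⁻¹ (x⁰ - x¹)`. -/
def boostedTime (β : ℝ) : Minkowski →L[ℝ] ℝ :=
  (β / 2) • advancedTime + (β⁻¹ / 2) • retardedTime

theorem boostedTime_apply (β : ℝ) (v : Minkowski) :
    boostedTime β v = (β * advancedTime v + β⁻¹ * retardedTime v) / 2 := by
  change β / 2 * advancedTime v + β⁻¹ / 2 * retardedTime v = _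
  ring

theorem sqrt_neg_metric_le_boostedTime {β : ℝ} (hβ : 0 < β) {v : Minkowski}
    (hv : IsFutureCausal v) : √(-metric v v) ≤ boostedTime β v := by
  obtain ⟨hadv, hret, -⟩ := isFutureCausal_iff.1 hv
  rw [boostedTime_apply, neg_metric_self]
  refine Real.sqrt_le_iff.2 ⟨by positivity, ?_⟩
  have hprod : advancedTime v * retardedTime v =
      (β * advancedTime v) * (β⁻¹ * retardedTime v) := by
    field_simp
  rw [hprod]
  nlinarith [sq_nonneg (β * advancedTime v - β⁻¹ * retardedTime v)]

/-- A `C¹` future directed causal curve; a causal curve is a concatenation of such pieces. -/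
structure IsCausalPiece (γ : ℝ → Minkowski) (a b : ℝ) : Prop where
  lt : a < b
  contDiffOn : ContDiffOn ℝ 1 γ (Set.Icc a b)
  isFutureCausal : ∀ t ∈ Set.Icc a b, IsFutureCausal (derivWithin γ (Set.Icc a b) t)

namespace IsCausalPiece

variable {γ : ℝ → Minkowski} {a b : ℝ} (h : IsCausalPiece γ a b)

include h

theorem derivWithin_clm_comp (L : Minkowski →L[ℝ] ℝ) {t : ℝ} (ht : t ∈ Set.Icc a b) :
    derivWithin (fun t => L (γ t)) (Set.Icc a b) t = L (derivWithin γ (Set.Icc a b) t) :=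
  (L.hasFDerivAt.comp_hasDerivWithinAt t
    (h.contDiffOn.differentiableOn one_ne_zero t ht).hasDerivWithinAt).derivWithin
      (uniqueDiffOn_Icc h.lt t ht)

theorem monotoneOn_clm_comp {L : Minkowski →L[ℝ] ℝ} (hL : ∀ v, IsFutureCausal v → 0 ≤ L v) :
    MonotoneOn (fun t => L (γ t)) (Set.Icc a b) := by
  have hc : ContDiffOn ℝ 1 (fun t => L (γ t)) (Set.Icc a b) :=
    L.contDiff.comp_contDiffOn h.contDiffOn
  refine monotoneOn_of_deriv_nonneg (convex_Icc a b) hc.continuousOn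
    ((hc.differentiableOn one_ne_zero).mono interior_subset) fun t ht => ?_
  have ht' := interior_subset ht
  rw [interior_Icc] at ht
  rw [← derivWithin_of_mem_nhds (Icc_mem_nhds ht.1 ht.2), h.derivWithin_clm_comp L ht']
  exact hL _ (h.isFutureCausal t ht')

theorem intervalIntegrable_properSpeed :
    IntervalIntegrable (fun t => √(-metric (deriv γ t) (deriv γ t))) volume a b := by
  have hγ' := h.contDiffOn.continuousOn_derivWithin (uniqueDiffOn_Icc h.lt) le_rfl
  have hc : ContinuousOn (fun t => √(-metric (derivWithin γ (Set.Icc a b) t)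
      (derivWithin γ (Set.Icc a b) t))) (Set.uIcc a b) := by
    rw [Set.uIcc_of_le h.lt.le]
    unfold metric
    fun_prop
  refine hc.intervalIntegrable.congr_uIoo fun t ht => ?_
  rw [Set.uIoo_of_le h.lt.le] at ht
  simp only [derivWithin_of_mem_nhds (Icc_mem_nhds ht.1 ht.2)]

theorem curveLength_le_boostedTime {β : ℝ} (hβ : 0 < β) :
    curveLength γ a b ≤ boostedTime β (γ b) - boostedTime β (γ a) := by
  have hc : ContDiffOn ℝ 1 (fun t => boostedTime β (γ t)) (Set.Icc a b) :=
    (boostedTime β).contDiff.comp_contDiffOn h.contDiffOn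
  have hd : IntervalIntegrable (derivWithin (fun t => boostedTime β (γ t)) (Set.Icc a b))
      volume a b :=
    (hc.continuousOn_derivWithin (uniqueDiffOn_Icc h.lt) le_rfl).intervalIntegrable_of_Icc h.lt.le
  rw [curveLength, ← intervalIntegral.integral_derivWithin_Icc_of_contDiffOn_Icc hc h.lt.le]
  refine intervalIntegral.integral_mono_on_of_le_Ioo h.lt.le h.intervalIntegrable_properSpeed hd
    fun t ht => ?_
  have ht' := Set.Ioo_subset_Icc_self ht
  rw [h.derivWithin_clm_comp _ ht', ← derivWithin_of_mem_nhds (Icc_mem_nhds ht.1 ht.2)]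
  exact sqrt_neg_metric_le_boostedTime hβ (h.isFutureCausal t ht')

end IsCausalPiece

theorem isCausalCurve_refl (γ : ℝ → Minkowski) (a : ℝ) : IsCausalCurve γ a a :=
  ⟨0, fun _ => a, rfl, rfl, by simp⟩

theorem isCausalCurve_segment (p : Minkowski) {v : Minkowski} (hv : IsFutureCausal v) :
    IsCausalCurve (fun t => p + t • v) 0 1 := by
  refine ⟨1, fun i => i, by simp, by simp, fun i _ => ?_⟩
  have hi : (i : ℝ) < ((i + 1 : ℕ) : ℝ) := by simp
  refine ⟨hi, by fun_prop, fun t ht => ?_⟩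
  have hd : HasDerivAt (fun t : ℝ => p + t • v) v t := by
    simpa using ((hasDerivAt_id t).smul_const v).const_add p
  rwa [hd.hasDerivWithinAt.derivWithin (uniqueDiffOn_Icc hi t ht)]

namespace IsCausalCurve

variable {γ : ℝ → Minkowski} {a b : ℝ}

theorem le_and_of_append (h : IsCausalCurve γ a b) {P : ℝ → Prop} (refl : P a)
    (append : ∀ t u, a ≤ t → IsCausalPiece γ t u → P t → P u) : a ≤ b ∧ P b := by
  obtain ⟨n, s, rfl, rfl, hs⟩ := h
  induction n with
  | zero => exact ⟨le_rfl, refl⟩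
  | succ n ih =>
    obtain ⟨hle, hP⟩ := ih fun i hi => hs i (hi.trans n.lt_succ_self)
    obtain ⟨hlt, hdiff, hcausal⟩ := hs n n.lt_succ_self
    exact ⟨hle.trans hlt.le, append _ _ hle ⟨hlt, hdiff, hcausal⟩ hP⟩

theorem le (h : IsCausalCurve γ a b) : a ≤ b :=
  (h.le_and_of_append (P := fun _ => True) trivial fun _ _ _ _ _ => trivial).1

theorem monotoneOn_clm_comp (h : IsCausalCurve γ a b) {L : Minkowski →L[ℝ] ℝ}
    (hL : ∀ v, IsFutureCausal v → 0 ≤ L v) : MonotoneOn (fun t => L (γ t)) (Set.Icc a b) := by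
  refine (h.le_and_of_append (P := fun t => MonotoneOn (fun t => L (γ t)) (Set.Icc a t))
    (by simp) fun t u hat hpiece hmono => ?_).2
  rw [← Set.Icc_union_Icc_eq_Icc hat hpiece.lt.le]
  exact hmono.union_right (hpiece.monotoneOn_clm_comp hL) (isGreatest_Icc hat)
    (isLeast_Icc hpiece.lt.le)

theorem clm_sub_nonneg (h : IsCausalCurve γ a b) {L : Minkowski →L[ℝ] ℝ}
    (hL : ∀ v, IsFutureCausal v → 0 ≤ L v) : 0 ≤ L (γ b - γ a) := by
  rw [map_sub, sub_nonneg]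
  exact h.monotoneOn_clm_comp hL (Set.left_mem_Icc.2 h.le) (Set.right_mem_Icc.2 h.le) h.le

theorem advancedTime_nonneg (h : IsCausalCurve γ a b) : 0 ≤ advancedTime (γ b - γ a) :=
  h.clm_sub_nonneg fun _ hv => (isFutureCausal_iff.1 hv).1

theorem retardedTime_nonneg (h : IsCausalCurve γ a b) : 0 ≤ retardedTime (γ b - γ a) :=
  h.clm_sub_nonneg fun _ hv => (isFutureCausal_iff.1 hv).2.1

theorem curveLength_le_boostedTime (h : IsCausalCurve γ a b) {β : ℝ} (hβ : 0 < β) :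
    curveLength γ a b ≤ boostedTime β (γ b - γ a) := by
  rw [map_sub]
  refine (h.le_and_of_append (P := fun t =>
    IntervalIntegrable (fun t => √(-metric (deriv γ t) (deriv γ t))) volume a t ∧
      curveLength γ a t ≤ boostedTime β (γ t) - boostedTime β (γ a))
    (by simp [curveLength]) fun t u _ hpiece ⟨hint, hle⟩ => ?_).2.2
  have hadd : curveLength γ a t + curveLength γ t u = curveLength γ a u :=
    intervalIntegral.integral_add_adjacent_intervals hint hpiece.intervalIntegrable_properSpeed
  exact ⟨hint.trans hpiece.intervalIntegrable_properSpeed,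
    by linarith [hle, hpiece.curveLength_le_boostedTime hβ]⟩

end IsCausalCurve

/-- The proper time along the straight segment from `p` to `q`; the value is the junk `0` if `q - p`
is space-like. -/
def properTime (p q : Minkowski) : ℝ :=
  √(-metric (q - p) (q - p))

theorem properTime_nonneg (p q : Minkowski) : 0 ≤ properTime p q :=
  Real.sqrt_nonneg _

theorem le_sqrt_mul_of_forall {l A B : ℝ} (hA : 0 ≤ A)
    (h : ∀ β : ℝ, 0 < β → l ≤ (β * A + β⁻¹ * B) / 2) : l ≤ √(A * B) := by
  rcases le_or_gt l 0 with hl | hl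
  · exact hl.trans (Real.sqrt_nonneg _)
  refine Real.le_sqrt_of_sq_le ?_
  rcases hA.eq_or_lt with rfl | hA
  · have hβ : 0 < (|B| + 1) / l := by positivity
    have := h _ hβ
    have hlt : ((|B| + 1) / l)⁻¹ * B < l := by
      rw [inv_div, div_mul_eq_mul_div, div_lt_iff₀ (by positivity)]
      nlinarith [le_abs_self B]
    linarith
  · have := h (l / A) (by positivity)
    rw [inv_div, div_mul_cancel₀ _ hA.ne', div_mul_eq_mul_div] at this
    have hle : l ≤ A * B / l := by linarith
    rw [le_div_iff₀ hl] at hle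
    linarith

theorem IsCausalCurve.curveLength_le_properTime {γ : ℝ → Minkowski} {a b : ℝ}
    (h : IsCausalCurve γ a b) : curveLength γ a b ≤ properTime (γ a) (γ b) := by
  rw [properTime, neg_metric_self]
  refine le_sqrt_mul_of_forall h.advancedTime_nonneg fun β hβ => ?_
  rw [← boostedTime_apply]
  exact h.curveLength_le_boostedTime hβ

theorem exists_isCausalCurve_curveLength_eq_properTime {p q : Minkowski}
    (hadv : 0 ≤ advancedTime (q - p)) (hret : 0 ≤ retardedTime (q - p)) :
    ∃ (γ : ℝ → Minkowski) (a b : ℝ), IsCausalCurve γ a b ∧ γ a = p ∧ γ b = q ∧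
      curveLength γ a b = properTime p q := by
  rcases eq_or_ne (q - p) 0 with hpq | hpq
  · obtain rfl : q = p := sub_eq_zero.1 hpq
    exact ⟨fun _ => q, 0, 0, isCausalCurve_refl _ 0, rfl, rfl,
      by simp [curveLength, properTime, metric]⟩
  · refine ⟨_, 0, 1, isCausalCurve_segment p (isFutureCausal_iff.2 ⟨hadv, hret, hpq⟩), by simp,
      by simp, ?_⟩
    have hd (t : ℝ) : deriv (fun t : ℝ => p + t • (q - p)) t = q - p := by
      simpa using (((hasDerivAt_id t).smul_const (q - p)).const_add p).deriv
    simp [curveLength, properTime, hd]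

theorem precedes_iff {p q : Minkowski} :
    Precedes p q ↔ 0 ≤ advancedTime (q - p) ∧ 0 ≤ retardedTime (q - p) := by
  constructor
  · rintro ⟨γ, a, b, h, rfl, rfl⟩
    exact ⟨h.advancedTime_nonneg, h.retardedTime_nonneg⟩
  · rintro ⟨hadv, hret⟩
    obtain ⟨γ, a, b, h, ha, hb, -⟩ := exists_isCausalCurve_curveLength_eq_properTime hadv hret
    exact ⟨γ, a, b, h, ha, hb⟩

theorem exists_boostedTime_eq_properTime {p q : Minkowski} (hadv : 0 < advancedTime (q - p))
    (hret : 0 < retardedTime (q - p)) :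
    ∃ β : ℝ, 0 < β ∧ boostedTime β (q - p) = properTime p q := by
  refine ⟨√(retardedTime (q - p)) / √(advancedTime (q - p)), by positivity, ?_⟩
  rw [boostedTime_apply, properTime, neg_metric_self, Real.sqrt_mul hadv.le]
  have hA := Real.sq_sqrt hadv.le
  have hB := Real.sq_sqrt hret.le
  have hA0 : 0 < √(advancedTime (q - p)) := Real.sqrt_pos.2 hadv
  have hB0 : 0 < √(retardedTime (q - p)) := Real.sqrt_pos.2 hret
  set A := √(advancedTime (q - p))
  set B := √(retardedTime (q - p))
  rw [← hA, ← hB]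
  field_simp
  norm_num

/-! ## Transport along causal segments -/

/-- The vector `z` with its relative phase, the longitude, increased by `θ`. -/
def rotate (θ : ℝ) (z : Fin 2 → ℂ) : Fin 2 → ℂ :=
  ![z 0, z 1 * Complex.exp (θ * Complex.I)]

theorem expectation_rotate (θ : ℝ) (z : Fin 2 → ℂ) {b : Matrix (Fin 2) (Fin 2) ℂ}
    (hb : b.IsHermitian) :
    expectation (rotate θ z) b = ‖z 0‖ ^ 2 * (b 0 0).re + ‖z 1‖ ^ 2 * (b 1 1).re +
      2 * (conj (z 0) * z 1 * Complex.exp (θ * Complex.I) * b 0 1).re := by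
  rw [expectation_of_isHermitian _ hb]
  simp only [rotate, Matrix.cons_val_zero, Matrix.cons_val_one, norm_mul,
    Complex.norm_exp_ofReal_mul_I, mul_one, mul_assoc]

section Transport

variable {d₁ d₂ : ℝ} {a : unitisation}

theorem coupling_le_null_expectation (ha : a ∈ causalCone d₁ d₂) (x : Minkowski)
    (w : Fin 2 → ℂ) (A B : ℝ) :
    4 * (d₁ - d₂) * (A * B) * (conj (w 0) * w 1 * a.1 x 0 1).im ≤
      A ^ 2 * expectation w (entryDeriv a (1, 1) x) +
        B ^ 2 * expectation w (entryDeriv a (1, -1) x) := by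
  have h := (mem_causalCone_iff.1 ha).2 x ((A : ℂ) • w) ((B * Complex.I) • w)
  rw [causalForm, expectation_smul_vec, expectation_smul_vec, norm_mul, Complex.norm_I, mul_one,
    Complex.norm_real, Complex.norm_real, Real.norm_eq_abs, Real.norm_eq_abs, sq_abs, sq_abs] at h
  have hcross : a.1 x 0 1 * (conj (((A : ℂ) • w) 0) * ((B * Complex.I) • w) 1 -
      conj (((B * Complex.I) • w) 0) * ((A : ℂ) • w) 1) =
      (2 * (A * B) : ℝ) * (Complex.I * (conj (w 0) * w 1 * a.1 x 0 1)) := by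
    simp only [Pi.smul_apply, smul_eq_mul, map_mul, Complex.conj_ofReal, Complex.conj_I]
    push_cast
    ring
  rw [hcross, Complex.re_ofReal_mul, Complex.I_mul_re] at h
  linarith

theorem le_expectation_entryDeriv (ha : a ∈ causalCone d₁ d₂) {e : Minkowski}
    (hadv : 0 ≤ advancedTime e) (hret : 0 ≤ retardedTime e) (x : Minkowski) (w : Fin 2 → ℂ) :
    2 * (|d₁ - d₂| * √(-metric e e)) * |(conj (w 0) * w 1 * a.1 x 0 1).im| ≤
      expectation w (entryDeriv a e x) := by
  set A := √(advancedTime e / 2)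
  set B := √(retardedTime e / 2)
  have hA : A ^ 2 = advancedTime e / 2 := Real.sq_sqrt (by positivity)
  have hB : B ^ 2 = retardedTime e / 2 := Real.sq_sqrt (by positivity)
  have he : e = A ^ 2 • (1, 1) + B ^ 2 • (1, -1) := by
    rw [hA, hB, advancedTime_apply, retardedTime_apply]
    ext <;> simp <;> ring
  have hAB : √(-metric e e) = 2 * (A * B) := by
    have hsq : -metric e e = (2 * (A * B)) ^ 2 := by
      rw [neg_metric_self, mul_pow, mul_pow, hA, hB]
      ring
    rw [hsq, Real.sqrt_sq (by positivity)]
  have hsplit : expectation w (entryDeriv a e x) =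
      A ^ 2 * expectation w (entryDeriv a (1, 1) x) +
        B ^ 2 * expectation w (entryDeriv a (1, -1) x) := by
    rw [he, entryDeriv_add, entryDeriv_smul, entryDeriv_smul, expectation_add, expectation_smul,
      expectation_smul]
  have hpos := coupling_le_null_expectation ha x w A B
  have hneg := coupling_le_null_expectation ha x w A (-B)
  rw [neg_sq] at hneg
  rw [hsplit, hAB]
  rcases abs_cases (d₁ - d₂) with ⟨h, -⟩ | ⟨h, -⟩ <;>
    rcases abs_cases (conj (w 0) * w 1 * a.1 x 0 1).im with ⟨h', -⟩ | ⟨h', -⟩ <;>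
    rw [h, h'] <;> linarith

theorem hasDerivAt_expectation_rotate (ha : ∀ x, (a.1 x).IsHermitian) (p e : Minkowski) (θ : ℝ)
    (z : Fin 2 → ℂ) (t : ℝ) :
    HasDerivAt (fun t : ℝ => expectation (rotate (t * θ) z) (a.1 (p + t • e)))
      (expectation (rotate (t * θ) z) (entryDeriv a e (p + t • e)) -
        2 * θ * (conj (rotate (t * θ) z 0) * rotate (t * θ) z 1 * a.1 (p + t • e) 0 1).im) t := by
  have hline : HasDerivAt (fun t : ℝ => p + t • e) e t := by
    simpa using ((hasDerivAt_id t).smul_const e).const_add p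
  have hentry (i j : Fin 2) : HasDerivAt (fun t : ℝ => a.1 (p + t • e) i j)
      (entryDeriv a e (p + t • e) i j) t :=
    ((hasBoundedDerivs_entry a i j).differentiable _).hasFDerivAt.comp_hasDerivAt t hline
  have hphase : HasDerivAt (fun t : ℝ => Complex.exp ((t * θ : ℝ) * Complex.I))
      (Complex.exp ((t * θ : ℝ) * Complex.I) * (θ * Complex.I)) t := by
    have h : HasDerivAt (fun t : ℝ => ((t * θ : ℝ) : ℂ) * Complex.I) (θ * Complex.I) t := by
      simpa using (((hasDerivAt_id t).mul_const θ).ofReal_comp).mul_const Complex.I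
    exact h.cexp
  have hre {f : ℝ → ℂ} {f' : ℂ} (h : HasDerivAt f f' t) :
      HasDerivAt (fun t => (f t).re) f'.re t :=
    Complex.reCLM.hasFDerivAt.comp_hasDerivAt t h
  simp only [expectation_rotate _ _ (ha _), expectation_rotate _ _ (isHermitian_entryDeriv ha _ _)]
  refine ((((hre (hentry 0 0)).const_mul (‖z 0‖ ^ 2)).add
    ((hre (hentry 1 1)).const_mul (‖z 1‖ ^ 2))).add
    ((hre ((hphase.const_mul (conj (z 0) * z 1)).mul (hentry 0 1))).const_mul 2)).congr_deriv ?_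
  simp only [rotate, Matrix.cons_val_zero, Matrix.cons_val_one, Complex.add_re, Complex.mul_re,
    Complex.mul_im, Complex.ofReal_re, Complex.ofReal_im, Complex.I_re, Complex.I_im]
  ring

theorem expectation_le_expectation_rotate (ha : a ∈ causalCone d₁ d₂) {p q : Minkowski}
    (hadv : 0 ≤ advancedTime (q - p)) (hret : 0 ≤ retardedTime (q - p)) {θ : ℝ}
    (hθ : |θ| ≤ |d₁ - d₂| * properTime p q) (z : Fin 2 → ℂ) :
    expectation z (a.1 p) ≤ expectation (rotate θ z) (a.1 q) := by
  have hmono : Monotone fun t : ℝ => expectation (rotate (t * θ) z) (a.1 (p + t • (q - p))) := by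
    refine monotone_of_hasDerivAt_nonneg
      (hasDerivAt_expectation_rotate ha.1 p (q - p) θ z) fun t => ?_
    have hspeed := le_expectation_entryDeriv ha hadv hret (p + t • (q - p)) (rotate (t * θ) z)
    set c := (conj (rotate (t * θ) z 0) * rotate (t * θ) z 1 * a.1 (p + t • (q - p)) 0 1).im
    have hphase : θ * c ≤ |d₁ - d₂| * properTime p q * |c| :=
      (le_abs_self _).trans ((abs_mul _ _).trans_le
        (mul_le_mul_of_nonneg_right hθ (abs_nonneg c)))
    rw [properTime] at hphase
    change 0 ≤ _ - _
    linarith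
  have hrotate : rotate 0 z = z := by
    ext i
    fin_cases i <;> simp [rotate]
  simpa [hrotate] using hmono zero_le_one

end Transport

theorem eq_mul_exp_toReal_arg_sub_arg {m m' : ℂ} (h : ‖m‖ = ‖m'‖) :
    m' = m * Complex.exp
      (((m'.arg : Real.Angle) - (m.arg : Real.Angle)).toReal * Complex.I) := by
  set θ : Real.Angle := m'.arg - m.arg with hθ
  have hexp : Complex.exp (m'.arg * Complex.I) =
      Complex.exp (m.arg * Complex.I) * Complex.exp (θ.toReal * Complex.I) := by
    have hadd : (m'.arg : Real.Angle).toCircle = (m.arg : Real.Angle).toCircle * θ.toCircle := by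
      rw [← Real.Angle.toCircle_add, hθ, add_sub_cancel]
    rw [← θ.coe_toReal] at hadd
    simpa only [Real.Angle.toCircle_coe, Circle.coe_mul, Circle.coe_exp] using
      congrArg Subtype.val hadd
  rw [← m'.norm_mul_exp_arg_mul_I, hexp, ← h, ← mul_assoc, m.norm_mul_exp_arg_mul_I]

theorem conj_mul_eq_mul_exp {ξ φ : EuclideanSpace ℂ (Fin 2)} (h₀ : ‖ξ 0‖ = ‖φ 0‖)
    (h₁ : ‖ξ 1‖ = ‖φ 1‖) :
    conj (φ 0) * φ 1 = conj (ξ 0) * ξ 1 *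
      Complex.exp ((longitude φ - longitude ξ).toReal * Complex.I) :=
  eq_mul_exp_toReal_arg_sub_arg (by simp [h₀, h₁])

theorem causallyPrecedes_of_angularDistance_le {d₁ d₂ : ℝ} {p q : Minkowski}
    {ξ φ : EuclideanSpace ℂ (Fin 2)} (hadv : 0 ≤ advancedTime (q - p))
    (hret : 0 ≤ retardedTime (q - p)) (h₀ : ‖ξ 0‖ = ‖φ 0‖) (h₁ : ‖ξ 1‖ = ‖φ 1‖)
    (h : angularDistance ξ φ ≤ |d₁ - d₂| * properTime p q) :
    CausallyPrecedes d₁ d₂ (pureState p ξ) (pureState q φ) := by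
  intro a ha
  have hφ : expectation φ (a.1 q) =
      expectation (rotate (longitude φ - longitude ξ).toReal ξ) (a.1 q) := by
    rw [expectation_rotate _ _ (ha.1 q), ← conj_mul_eq_mul_exp h₀ h₁, h₀, h₁,
      expectation_of_isHermitian _ (ha.1 q)]
  rw [pureState_le_iff ha.1, hφ]
  exact expectation_le_expectation_rotate ha hadv hret h ξ

/-! ## Elements of the causal cone -/

section IsCausalFunction

theorem isCausalFunction_comp_clm {f : ℝ → ℝ} (hf : HasBoundedDerivs f) (hmono : Monotone f)
    {L : Minkowski →L[ℝ] ℝ} (hL : ∀ v, IsFutureCausal v → 0 ≤ L v) :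
    IsCausalFunction fun x => f (L x) where
  smooth := (hf.comp_clm L).smooth
  bounded := (hf.comp_clm L).bounded
  mono _ _ _ h := hmono.comp_monotoneOn (h.monotoneOn_clm_comp hL)

theorem isCausalFunction_const (c : ℝ) : IsCausalFunction fun _ => c where
  smooth := contDiff_const
  bounded := (hasBoundedDerivs_const c).bounded
  mono _ _ _ _ := monotoneOn_const

variable {f g : Minkowski → ℝ}

theorem IsCausalFunction.add (hf : IsCausalFunction f) (hg : IsCausalFunction g) :
    IsCausalFunction fun x => f x + g x where
  smooth := (hf.hasBoundedDerivs.add hg.hasBoundedDerivs).smooth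
  bounded := (hf.hasBoundedDerivs.add hg.hasBoundedDerivs).bounded
  mono γ a b h := (hf.mono γ a b h).add (hg.mono γ a b h)

theorem IsCausalFunction.const_mul (hf : IsCausalFunction f) {c : ℝ} (hc : 0 ≤ c) :
    IsCausalFunction fun x => c * f x where
  smooth := (hf.hasBoundedDerivs.clm_comp (ContinuousLinearMap.mul ℝ ℝ c)).smooth
  bounded := (hf.hasBoundedDerivs.clm_comp (ContinuousLinearMap.mul ℝ ℝ c)).bounded
  mono γ a b h := fun _ hx _ hy hxy => mul_le_mul_of_nonneg_left (hf.mono γ a b h hx hy hxy) hc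

theorem IsCausalFunction.fderiv_nonneg (hf : IsCausalFunction f) (x : Minkowski) {v : Minkowski}
    (hv : IsFutureCausal v) : 0 ≤ fderiv ℝ f x v := by
  have hline : HasDerivAt (fun t : ℝ => x + t • v) v 0 := by
    simpa using ((hasDerivAt_id (0 : ℝ)).smul_const v).const_add x
  have hderiv : HasDerivAt (fun t : ℝ => f (x + t • v)) (fderiv ℝ f x v) 0 := by
    have h := (hf.hasBoundedDerivs.differentiable (x + (0 : ℝ) • v)).hasFDerivAt.comp_hasDerivAt 0
      hline
    rwa [zero_smul, add_zero] at h
  have hnonneg := (hf.mono _ _ _ (isCausalCurve_segment x hv)).derivWithin_nonneg (x := 0)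
  rwa [hderiv.hasDerivWithinAt.derivWithin (uniqueDiffOn_Icc zero_lt_one 0 (by simp))] at hnonneg

end IsCausalFunction

/-- The element `[[f, ρ], [ρ, g]]` of the unitisation. -/
def realElement {f g : Minkowski → ℝ} (hf : IsCausalFunction f) (hg : IsCausalFunction g)
    (ρ : 𝓢(Minkowski, ℝ)) : unitisation :=
  ⟨fun x => !![(f x : ℂ), (ρ x : ℂ); (ρ x : ℂ), (g x : ℂ)], by
    have hρ : (fun x => (ρ x : ℂ)) ∈ schwartzM :=
      ⟨SchwartzMap.postcompCLM (𝕜 := ℝ) Complex.ofRealCLM ρ, rfl⟩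
    constructor
    · intro i
      fin_cases i
      · exact Submodule.subset_span ⟨f, hf, rfl⟩
      · exact Submodule.subset_span ⟨g, hg, rfl⟩
    · intro i j hij
      fin_cases i <;> fin_cases j
      · exact absurd rfl hij
      · exact hρ
      · exact hρ
      · exact absurd rfl hij⟩

theorem fderiv_ofReal {f : Minkowski → ℝ} (hf : Differentiable ℝ f) (x v : Minkowski) :
    fderiv ℝ (fun y => (f y : ℂ)) x v = ((fderiv ℝ f x v : ℝ) : ℂ) :=
  congrArg (· v) (Complex.ofRealCLM.hasFDerivAt.comp x (hf x).hasFDerivAt).fderiv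

section realElement

variable {f g : Minkowski → ℝ} (hf : IsCausalFunction f) (hg : IsCausalFunction g)
  (ρ : 𝓢(Minkowski, ℝ))

theorem isHermitian_realElement (x : Minkowski) : ((realElement hf hg ρ).1 x).IsHermitian := by
  ext i j
  fin_cases i <;> fin_cases j <;> simp [realElement]

theorem expectation_real (z : Fin 2 → ℂ) (r s t : ℝ) :
    expectation z !![(r : ℂ), (t : ℂ); (t : ℂ), (s : ℂ)] =
      ‖z 0‖ ^ 2 * r + ‖z 1‖ ^ 2 * s + 2 * (t * (conj (z 0) * z 1).re) := by
  rw [expectation_of_isHermitian, mul_comm (t : ℝ)]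
  · simp
  · ext i j
    fin_cases i <;> fin_cases j <;> simp

theorem expectation_realElement (z : Fin 2 → ℂ) (x : Minkowski) :
    expectation z ((realElement hf hg ρ).1 x) =
      ‖z 0‖ ^ 2 * f x + ‖z 1‖ ^ 2 * g x + 2 * (ρ x * (conj (z 0) * z 1).re) :=
  expectation_real z _ _ _

theorem expectation_entryDeriv_realElement (z : Fin 2 → ℂ) (e x : Minkowski) :
    expectation z (entryDeriv (realElement hf hg ρ) e x) =
      ‖z 0‖ ^ 2 * fderiv ℝ f x e + ‖z 1‖ ^ 2 * fderiv ℝ g x e +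
        2 * (fderiv ℝ ρ x e * (conj (z 0) * z 1).re) := by
  rw [← expectation_real]
  congr 1
  ext i j
  fin_cases i <;> fin_cases j
  · exact fderiv_ofReal hf.hasBoundedDerivs.differentiable x e
  · exact fderiv_ofReal ρ.differentiable x e
  · exact fderiv_ofReal ρ.differentiable x e
  · exact fderiv_ofReal hg.hasBoundedDerivs.differentiable x e

theorem causalForm_realElement (d₁ d₂ : ℝ) (x : Minkowski) (y z : Fin 2 → ℂ) :
    causalForm d₁ d₂ (realElement hf hg ρ) x y z =
      ‖y 0‖ ^ 2 * fderiv ℝ f x (1, 1) + ‖y 1‖ ^ 2 * fderiv ℝ g x (1, 1) +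
        2 * (fderiv ℝ ρ x (1, 1) * (conj (y 0) * y 1).re) +
      (‖z 0‖ ^ 2 * fderiv ℝ f x (1, -1) + ‖z 1‖ ^ 2 * fderiv ℝ g x (1, -1) +
        2 * (fderiv ℝ ρ x (1, -1) * (conj (z 0) * z 1).re)) +
      2 * ((d₁ - d₂) * ρ x) * (conj (y 0) * z 1 - conj (z 0) * y 1).re := by
  rw [causalForm, expectation_entryDeriv_realElement, expectation_entryDeriv_realElement]
  change _ + 2 * (d₁ - d₂) * ((ρ x : ℂ) * _).re = _
  rw [Complex.re_ofReal_mul]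
  ring

end realElement

theorem isFutureCausal_one_one : IsFutureCausal (1, 1) := by norm_num [IsFutureCausal, metric]

theorem isFutureCausal_one_neg_one : IsFutureCausal (1, -1) := by
  norm_num [IsFutureCausal, metric]

theorem realElement_zero_mem_causalCone (d₁ d₂ : ℝ) {f g : Minkowski → ℝ}
    (hf : IsCausalFunction f) (hg : IsCausalFunction g) :
    realElement hf hg 0 ∈ causalCone d₁ d₂ := by
  refine mem_causalCone_iff.2 ⟨isHermitian_realElement hf hg 0, fun x y z => ?_⟩
  have hf₁ := hf.fderiv_nonneg x isFutureCausal_one_one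
  have hf₂ := hf.fderiv_nonneg x isFutureCausal_one_neg_one
  have hg₁ := hg.fderiv_nonneg x isFutureCausal_one_one
  have hg₂ := hg.fderiv_nonneg x isFutureCausal_one_neg_one
  have h0 : fderiv ℝ (0 : 𝓢(Minkowski, ℝ)) x = 0 := fderiv_const_apply (0 : ℝ)
  rw [causalForm_realElement, h0]
  simp only [zero_apply, zero_mul, mul_zero, add_zero]
  positivity

theorem quadratic_nonneg {U V κ : ℝ} (hU : 0 ≤ U) (hV : 0 ≤ V) (hκ : κ ^ 2 ≤ U * V) (s t : ℂ) :
    0 ≤ U * ‖s‖ ^ 2 + V * ‖t‖ ^ 2 + 2 * (κ * (conj s * t).re) := by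
  have hre : |(conj s * t).re| ≤ ‖s‖ * ‖t‖ := by
    simpa only [norm_mul, RCLike.norm_conj] using Complex.abs_re_le_norm (conj s * t)
  have hcross : |κ * (conj s * t).re| ≤ √U * ‖s‖ * (√V * ‖t‖) := by
    rw [abs_mul, mul_mul_mul_comm, ← Real.sqrt_mul hU]
    exact mul_le_mul (Real.abs_le_sqrt hκ) hre (abs_nonneg _) (Real.sqrt_nonneg _)
  have hamgm := two_mul_le_add_sq (√U * ‖s‖) (√V * ‖t‖)
  rw [mul_pow, mul_pow, Real.sq_sqrt hU, Real.sq_sqrt hV] at hamgm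
  linarith [neg_abs_le (κ * (conj s * t).re)]

/-- Positivity of the quadratic form of `[[α, ρ], [ρ, α]]` on the fibre vectors with spinor
components `(s, s)` and `(t, -t)`, where `k` is `d₁ - d₂`. The complementary vectors, with
components `(s, -s)` and `(t, t)`, are accounted for by `-ρ`. -/
def SplitPositive (k : ℝ) (α ρ : Minkowski → ℝ) : Prop :=
  ∀ x, 0 ≤ fderiv ℝ α x (1, 1) + fderiv ℝ ρ x (1, 1) ∧
    0 ≤ fderiv ℝ α x (1, -1) - fderiv ℝ ρ x (1, -1) ∧
    (k * ρ x) ^ 2 ≤ (fderiv ℝ α x (1, 1) + fderiv ℝ ρ x (1, 1)) *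
      (fderiv ℝ α x (1, -1) - fderiv ℝ ρ x (1, -1))

theorem realElement_mem_causalCone {d₁ d₂ : ℝ} {α : Minkowski → ℝ} (hα : IsCausalFunction α)
    {ρ : 𝓢(Minkowski, ℝ)} (hpos : SplitPositive (d₁ - d₂) α ρ)
    (hneg : SplitPositive (d₁ - d₂) α (-ρ)) : realElement hα hα ρ ∈ causalCone d₁ d₂ := by
  refine mem_causalCone_iff.2 ⟨isHermitian_realElement hα hα ρ, fun x y z => ?_⟩
  obtain ⟨hU, hV, hUV⟩ := hpos x
  obtain ⟨hU', hV', hUV'⟩ := hneg x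
  simp only [fderiv_neg, neg_apply, Pi.neg_apply, mul_neg, neg_sq] at hU' hV' hUV'
  rw [← neg_sq] at hUV
  have h := quadratic_nonneg hU hV hUV (y 0 + y 1) (z 0 - z 1)
  have h' := quadratic_nonneg hU' hV' hUV' (y 0 - y 1) (z 0 + z 1)
  rw [causalForm_realElement]
  simp only [← Complex.normSq_eq_norm_sq, Complex.normSq_apply, Complex.mul_re, Complex.add_re,
    Complex.sub_re, Complex.add_im, Complex.sub_im, map_add, map_sub, Complex.conj_re,
    Complex.conj_im] at h h' ⊢
  linarith

/-- The element `s* a s` of the unitisation, for a constant diagonal matrix `s`. -/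
def diagConj (s : Fin 2 → ℂ) (a : unitisation) : unitisation :=
  ⟨fun x => Matrix.of fun i j => conj (s i) * s j * a.1 x i j,
    fun i => unitisationM.smul_mem (conj (s i) * s i) (a.2.1 i),
    fun i j hij => schwartzM.smul_mem (conj (s i) * s j) (a.2.2 i j hij)⟩

section diagConj

variable (s : Fin 2 → ℂ) (a : unitisation)

theorem expectation_of_conj_mul_mul (z : Fin 2 → ℂ) (b : Matrix (Fin 2) (Fin 2) ℂ) :
    expectation z (Matrix.of fun i j => conj (s i) * s j * b i j) = expectation (s * z) b := by
  simp only [expectation, Matrix.of_apply, Pi.mul_apply, map_mul]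
  congr 1
  exact Finset.sum_congr rfl fun i _ => Finset.sum_congr rfl fun j _ => by ring

theorem expectation_diagConj (z : Fin 2 → ℂ) (x : Minkowski) :
    expectation z ((diagConj s a).1 x) = expectation (s * z) (a.1 x) :=
  expectation_of_conj_mul_mul s z (a.1 x)

theorem entryDeriv_diagConj (e x : Minkowski) :
    entryDeriv (diagConj s a) e x =
      Matrix.of fun i j => conj (s i) * s j * entryDeriv a e x i j := by
  ext i j
  exact congrArg (· e) (fderiv_const_mul ((hasBoundedDerivs_entry a i j).differentiable x)
    (conj (s i) * s j))

theorem causalForm_diagConj (d₁ d₂ : ℝ) (x : Minkowski) (y z : Fin 2 → ℂ) :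
    causalForm d₁ d₂ (diagConj s a) x y z = causalForm d₁ d₂ a x (s * y) (s * z) := by
  rw [causalForm, causalForm, entryDeriv_diagConj, entryDeriv_diagConj,
    expectation_of_conj_mul_mul, expectation_of_conj_mul_mul]
  congr 3
  simp only [diagConj, Matrix.of_apply, Pi.mul_apply, map_mul]
  ring

variable {s a}

theorem diagConj_mem_causalCone {d₁ d₂ : ℝ} (ha : a ∈ causalCone d₁ d₂) :
    diagConj s a ∈ causalCone d₁ d₂ := by
  refine mem_causalCone_iff.2 ⟨fun x => ?_, fun x y z => ?_⟩
  · ext i j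
    have hij : conj (a.1 x j i) = a.1 x i j := (ha.1 x).apply i j
    change conj (conj (s j) * s i * a.1 x j i) = conj (s i) * s j * a.1 x i j
    rw [map_mul, map_mul, Complex.conj_conj, hij]
    ring
  · rw [causalForm_diagConj]
    exact (mem_causalCone_iff.1 ha).2 x _ _

end diagConj

/-! ## Cutoffs and trigonometric profiles -/

section smoothStep

variable {a b : ℝ}

/-- A smooth monotone step, equal to `0` on `(-∞, a]` and to `1` on `[b, ∞)`; meant for `a < b`. -/
def smoothStep (a b x : ℝ) : ℝ := Real.smoothTransition ((x - a) / (b - a))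

theorem smoothStep_of_le (hab : a < b) {x : ℝ} (hx : x ≤ a) : smoothStep a b x = 0 :=
  Real.smoothTransition.zero_of_nonpos
    (div_nonpos_of_nonpos_of_nonneg (sub_nonpos.2 hx) (sub_pos.2 hab).le)

theorem smoothStep_of_ge (hab : a < b) {x : ℝ} (hx : b ≤ x) : smoothStep a b x = 1 :=
  Real.smoothTransition.one_of_one_le
    ((one_le_div (sub_pos.2 hab)).2 (sub_le_sub_right hx a))

theorem smoothStep_nonneg (a b x : ℝ) : 0 ≤ smoothStep a b x := Real.smoothTransition.nonneg _

theorem smoothStep_le_one (a b x : ℝ) : smoothStep a b x ≤ 1 := Real.smoothTransition.le_one _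

theorem monotone_smoothStep (hab : a < b) : Monotone (smoothStep a b) := fun _ _ h =>
  Real.smoothTransition.monotone
    (div_le_div_of_nonneg_right (sub_le_sub_right h a) (sub_pos.2 hab).le)

theorem hasBoundedDerivs_smoothStep (hab : a < b) : HasBoundedDerivs (smoothStep a b) := by
  have hsmooth : ContDiff ℝ ∞ (smoothStep a b) :=
    Real.smoothTransition.contDiff.comp ((contDiff_id.sub contDiff_const).div_const _)
  refine hasBoundedDerivs_of_hasCompactSupport_deriv hsmooth (C := 1) (fun x => ?_) ?_
  · rw [Real.norm_of_nonneg (smoothStep_nonneg a b x)]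
    exact smoothStep_le_one a b x
  · refine HasCompactSupport.intro (isCompact_Icc (a := a) (b := b)) fun x hx => ?_
    have hlocal : ∃ c, smoothStep a b =ᶠ[nhds x] fun _ => c := by
      rcases lt_or_gt_of_ne (show x ≠ a by rintro rfl; exact hx ⟨le_rfl, hab.le⟩) with hxa | hxa
      · exact ⟨0, Filter.mem_of_superset (Iio_mem_nhds hxa) fun y hy => smoothStep_of_le hab hy.le⟩
      · have hxb : b < x := not_le.1 fun h => hx ⟨hxa.le, h⟩
        exact ⟨1, Filter.mem_of_superset (Ioi_mem_nhds hxb) fun y hy => smoothStep_of_ge hab hy.le⟩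
    obtain ⟨c, hc⟩ := hlocal
    rw [hc.deriv_eq, deriv_const]

end smoothStep

section cutoff

variable {ε a b : ℝ}

/-- A smooth cutoff function for the interval `[a, b]`, supported in `[a - ε, b + ε]`. -/
def cutoff (ε a b x : ℝ) : ℝ := smoothStep (a - ε) a x - smoothStep b (b + ε) x

/-- A smooth non-decreasing function which is constant on `[a, b]` and whose derivative dominates
that of `cutoff ε a b`. -/
def ramp (ε a b x : ℝ) : ℝ := smoothStep (a - ε) a x + smoothStep b (b + ε) x

theorem cutoff_nonneg (hε : 0 < ε) (hab : a ≤ b) (x : ℝ) : 0 ≤ cutoff ε a b x := by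
  rw [cutoff, sub_nonneg]
  rcases le_total a x with hx | hx
  · exact (smoothStep_le_one _ _ _).trans_eq (smoothStep_of_ge (sub_lt_self a hε) hx).symm
  · exact (smoothStep_of_le (lt_add_of_pos_right b hε) (hx.trans hab)).trans_le
      (smoothStep_nonneg _ _ _)

theorem cutoff_le_one (ε a b x : ℝ) : cutoff ε a b x ≤ 1 :=
  (sub_le_self _ (smoothStep_nonneg _ _ _)).trans (smoothStep_le_one _ _ _)

theorem cutoff_of_mem (hε : 0 < ε) {x : ℝ} (hx : x ∈ Set.Icc a b) : cutoff ε a b x = 1 := by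
  rw [cutoff, smoothStep_of_ge (sub_lt_self a hε) hx.1,
    smoothStep_of_le (lt_add_of_pos_right b hε) hx.2, sub_zero]

theorem ramp_of_mem (hε : 0 < ε) {x : ℝ} (hx : x ∈ Set.Icc a b) : ramp ε a b x = 1 := by
  rw [ramp, smoothStep_of_ge (sub_lt_self a hε) hx.1,
    smoothStep_of_le (lt_add_of_pos_right b hε) hx.2, add_zero]

theorem mem_Icc_of_cutoff_ne_zero (hε : 0 < ε) (hab : a ≤ b) {x : ℝ} (hx : cutoff ε a b x ≠ 0) :
    x ∈ Set.Icc (a - ε) (b + ε) := by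
  by_contra hmem
  refine hx (sub_eq_zero.2 ?_)
  rcases not_and_or.1 hmem with h | h
  · have hxa : x ≤ a - ε := (not_le.1 h).le
    rw [smoothStep_of_le (sub_lt_self a hε) hxa,
      smoothStep_of_le (lt_add_of_pos_right b hε) (by linarith)]
  · have hbx : b + ε ≤ x := (not_le.1 h).le
    rw [smoothStep_of_ge (sub_lt_self a hε) (by linarith),
      smoothStep_of_ge (lt_add_of_pos_right b hε) hbx]

theorem contDiff_cutoff (hε : 0 < ε) (a b : ℝ) : ContDiff ℝ ∞ (cutoff ε a b) :=
  (hasBoundedDerivs_smoothStep (sub_lt_self a hε)).smooth.sub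
    (hasBoundedDerivs_smoothStep (lt_add_of_pos_right b hε)).smooth

theorem hasBoundedDerivs_ramp (hε : 0 < ε) (a b : ℝ) : HasBoundedDerivs (ramp ε a b) :=
  (hasBoundedDerivs_smoothStep (sub_lt_self a hε)).add
    (hasBoundedDerivs_smoothStep (lt_add_of_pos_right b hε))

theorem monotone_ramp (hε : 0 < ε) (a b : ℝ) : Monotone (ramp ε a b) :=
  (monotone_smoothStep (sub_lt_self a hε)).add (monotone_smoothStep (lt_add_of_pos_right b hε))

theorem abs_deriv_cutoff_le (hε : 0 < ε) (a b x : ℝ) :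
    |deriv (cutoff ε a b) x| ≤ deriv (ramp ε a b) x := by
  have ha := sub_lt_self a hε
  have hb := lt_add_of_pos_right b hε
  have hda := ((hasBoundedDerivs_smoothStep ha).differentiable x).hasDerivAt
  have hdb := ((hasBoundedDerivs_smoothStep hb).differentiable x).hasDerivAt
  have hsub : deriv (cutoff ε a b) x = _ := (hda.sub hdb).deriv
  have hadd : deriv (ramp ε a b) x = _ := (hda.add hdb).deriv
  rw [hsub, hadd]
  refine (abs_sub _ _).trans_eq ?_
  rw [abs_of_nonneg (monotone_smoothStep ha).deriv_nonneg,
    abs_of_nonneg (monotone_smoothStep hb).deriv_nonneg]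

end cutoff

section clamp

variable {c : ℝ} (b : ContDiffBump c)

/-- A smooth bounded function of `t` which coincides with `t - c` for `|t - c| ≤ b.rIn`. -/
def clamp (t : ℝ) : ℝ := ∫ x in c..t, b x

theorem hasDerivAt_clamp (t : ℝ) : HasDerivAt (clamp b) (b t) t :=
  (b.continuous.integral_hasStrictDerivAt c t).hasDerivAt

theorem contDiff_clamp : ContDiff ℝ ∞ (clamp b) := by
  refine contDiff_infty_iff_deriv.2 ⟨fun t => (hasDerivAt_clamp b t).differentiableAt, ?_⟩
  rw [funext fun t => (hasDerivAt_clamp b t).deriv]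
  exact b.contDiff

theorem clamp_of_abs_sub_le {t : ℝ} (ht : |t - c| ≤ b.rIn) : clamp b t = t - c := by
  have hone : ∀ x ∈ Set.uIcc c t, b x = 1 := fun x hx =>
    b.one_of_mem_closedBall ((Set.abs_sub_left_of_mem_uIcc hx).trans ht)
  rw [clamp, intervalIntegral.integral_congr hone]
  simp

theorem abs_clamp_le_abs_sub (t : ℝ) : |clamp b t| ≤ |t - c| := by
  have h := intervalIntegral.norm_integral_le_of_norm_le_const (f := b) (a := c) (b := t) (C := 1)
    fun x _ => (Real.norm_of_nonneg b.nonneg).trans_le b.le_one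
  rwa [one_mul] at h

theorem clamp_eq_of_forall_mem_uIcc {s t : ℝ} (h : ∀ x ∈ Set.uIcc s t, b.rOut ≤ |x - c|) :
    clamp b t = clamp b s := by
  have hzero : ∀ x ∈ Set.uIcc s t, b x = 0 := fun x hx => b.zero_of_le_dist (h x hx)
  rw [clamp, clamp, ← intervalIntegral.integral_add_adjacent_intervals
    (b.continuous.intervalIntegrable c s) (b.continuous.intervalIntegrable s t),
    intervalIntegral.integral_congr hzero]
  simp

theorem abs_clamp_le (t : ℝ) : |clamp b t| ≤ b.rOut := by
  rcases le_total |t - c| b.rOut with ht | ht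
  · exact (abs_clamp_le_abs_sub b t).trans ht
  have hout := b.rOut_pos
  obtain ⟨s, hs, hst⟩ : ∃ s, |s - c| = b.rOut ∧ ∀ x ∈ Set.uIcc s t, b.rOut ≤ |x - c| := by
    rcases le_abs'.1 ht with ht | ht
    · refine ⟨c - b.rOut, by rw [sub_sub_cancel_left, abs_neg, abs_of_pos hout], fun x hx => ?_⟩
      rw [Set.uIcc_of_ge (by linarith)] at hx
      exact le_abs'.2 (Or.inl (by linarith [hx.2]))
    · refine ⟨c + b.rOut, by rw [add_sub_cancel_left, abs_of_pos hout], fun x hx => ?_⟩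
      rw [Set.uIcc_of_le (by linarith)] at hx
      exact le_abs'.2 (Or.inr (by linarith [hx.1]))
  rw [clamp_eq_of_forall_mem_uIcc b hst, ← hs]
  exact abs_clamp_le_abs_sub b s

/-- The function `tan (k * (t - c))` of `t`, with its argument smoothly clamped. -/
def clampedTan (k : ℝ) (t : ℝ) : ℝ := Real.tan (k * clamp b t)

/-- The function `1 / cos (k * (t - c))` of `t`, with its argument smoothly clamped. -/
def clampedSec (k : ℝ) (t : ℝ) : ℝ := (Real.cos (k * clamp b t))⁻¹

theorem clampedTan_add (k : ℝ) {h : ℝ} (hh : |h| ≤ b.rIn) :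
    clampedTan b k (c + h) = Real.tan (k * h) := by
  rw [clampedTan, clamp_of_abs_sub_le b (by rwa [add_sub_cancel_left]), add_sub_cancel_left]

theorem clampedSec_add (k : ℝ) {h : ℝ} (hh : |h| ≤ b.rIn) :
    clampedSec b k (c + h) = (Real.cos (k * h))⁻¹ := by
  rw [clampedSec, clamp_of_abs_sub_le b (by rwa [add_sub_cancel_left]), add_sub_cancel_left]

variable {b} {k : ℝ} (hk : 0 ≤ k) (hkb : k * b.rOut < Real.pi / 2)
include hk hkb

theorem cos_le_cos_mul_clamp (t : ℝ) : Real.cos (k * b.rOut) ≤ Real.cos (k * clamp b t) := by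
  rw [← Real.cos_abs (k * clamp b t), abs_mul, abs_of_nonneg hk]
  exact Real.cos_le_cos_of_nonneg_of_le_pi (by positivity) (by linarith [Real.pi_pos])
    (mul_le_mul_of_nonneg_left (abs_clamp_le b t) hk)

theorem cos_mul_rOut_pos : 0 < Real.cos (k * b.rOut) :=
  Real.cos_pos_of_mem_Ioo
    ⟨by linarith [Real.pi_pos, mul_nonneg hk b.rOut_pos.le], hkb⟩

theorem cos_mul_clamp_pos (t : ℝ) : 0 < Real.cos (k * clamp b t) :=
  (cos_mul_rOut_pos hk hkb).trans_le (cos_le_cos_mul_clamp hk hkb t)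

theorem abs_clampedSec_le (t : ℝ) : |clampedSec b k t| ≤ (Real.cos (k * b.rOut))⁻¹ := by
  rw [clampedSec, abs_of_pos (inv_pos.2 (cos_mul_clamp_pos hk hkb t))]
  exact inv_anti₀ (cos_mul_rOut_pos hk hkb) (cos_le_cos_mul_clamp hk hkb t)

theorem contDiff_clampedSec : ContDiff ℝ ∞ (clampedSec b k) :=
  (Real.contDiff_cos.comp (contDiff_const.mul (contDiff_clamp b))).inv
    fun t => (cos_mul_clamp_pos hk hkb t).ne'

theorem hasDerivAt_clampedTan (t : ℝ) :
    HasDerivAt (clampedTan b k) (k * b t * clampedSec b k t ^ 2) t := by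
  refine ((Real.hasDerivAt_tan (cos_mul_clamp_pos hk hkb t).ne').comp t
    ((hasDerivAt_clamp b t).const_mul k)).congr_deriv ?_
  rw [clampedSec, inv_pow, one_div, mul_comm]

theorem hasDerivAt_clampedSec (t : ℝ) : HasDerivAt (clampedSec b k)
    (k * b t * clampedSec b k t ^ 2 * Real.sin (k * clamp b t)) t := by
  refine (((Real.hasDerivAt_cos _).comp t ((hasDerivAt_clamp b t).const_mul k)).inv
    (cos_mul_clamp_pos hk hkb t).ne').congr_deriv ?_
  simp only [clampedSec, Function.comp_apply]
  ring

theorem deriv_clampedTan_nonneg (t : ℝ) : 0 ≤ deriv (clampedTan b k) t := by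
  rw [(hasDerivAt_clampedTan hk hkb t).deriv]
  exact mul_nonneg (mul_nonneg hk b.nonneg) (sq_nonneg _)

theorem differentiable_clampedTan : Differentiable ℝ (clampedTan b k) :=
  fun t => (hasDerivAt_clampedTan hk hkb t).differentiableAt

theorem monotone_clampedTan : Monotone (clampedTan b k) :=
  monotone_of_deriv_nonneg (differentiable_clampedTan hk hkb) (deriv_clampedTan_nonneg hk hkb)

theorem hasBoundedDerivs_clampedTan : HasBoundedDerivs (clampedTan b k) := by
  have htan : clampedTan b k = fun t => Real.sin (k * clamp b t) * clampedSec b k t :=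
    funext fun t => Real.tan_eq_sin_div_cos _
  have hsmooth : ContDiff ℝ ∞ (clampedTan b k) := by
    rw [htan]
    exact (Real.contDiff_sin.comp (contDiff_const.mul (contDiff_clamp b))).mul
      (contDiff_clampedSec hk hkb)
  refine hasBoundedDerivs_of_hasCompactSupport_deriv hsmooth
    (C := (Real.cos (k * b.rOut))⁻¹) (fun t => ?_) ?_
  · rw [htan, norm_mul, Real.norm_eq_abs, Real.norm_eq_abs]
    exact (mul_le_of_le_one_left (abs_nonneg _) (Real.abs_sin_le_one _)).trans
      (abs_clampedSec_le hk hkb t)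
  · rw [funext fun t => (hasDerivAt_clampedTan hk hkb t).deriv]
    exact b.hasCompactSupport.mul_left.mul_right

theorem abs_deriv_clampedSec_le (t : ℝ) :
    |deriv (clampedSec b k) t| ≤ deriv (clampedTan b k) t := by
  have hnonneg := deriv_clampedTan_nonneg hk hkb t
  rw [(hasDerivAt_clampedTan hk hkb t).deriv] at hnonneg ⊢
  rw [(hasDerivAt_clampedSec hk hkb t).deriv, abs_mul, abs_of_nonneg hnonneg]
  exact mul_le_of_le_one_right hnonneg (Real.abs_sin_le_one _)

theorem deriv_clampedSec_sq_add {t : ℝ} (ht : |t - c| ≤ b.rIn) :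
    deriv (clampedSec b k) t ^ 2 + (k * clampedSec b k t) ^ 2 = deriv (clampedTan b k) t ^ 2 := by
  have hb : b t = 1 := b.one_of_mem_closedBall ht
  have hcos : clampedSec b k t * Real.cos (k * clamp b t) = 1 :=
    inv_mul_cancel₀ (cos_mul_clamp_pos hk hkb t).ne'
  rw [(hasDerivAt_clampedTan hk hkb t).deriv, (hasDerivAt_clampedSec hk hkb t).deriv, hb,
    mul_pow _ (Real.sin _), Real.sin_sq]
  linear_combination (-(k * clampedSec b k t) ^ 2) *
    (clampedSec b k t * Real.cos (k * clamp b t) + 1) * hcos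

end clamp

/-! ## Separating elements of the causal cone -/

section window

variable {ε : ℝ} {p q : Minkowski}

/-- A smooth cutoff function for the double cone of `p` and `q`, a rectangle in light cone
coordinates. -/
def window (ε : ℝ) (p q x : Minkowski) : ℝ :=
  cutoff ε (advancedTime p) (advancedTime q) (advancedTime x) *
    cutoff ε (retardedTime p) (retardedTime q) (retardedTime x)

/-- A causal function whose derivatives along causal vectors dominate those of `window ε p q`, and
which takes the same value at `p` and at `q`. -/
def windowRamp (ε : ℝ) (p q x : Minkowski) : ℝ :=
  ramp ε (advancedTime p) (advancedTime q) (advancedTime x) +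
    ramp ε (retardedTime p) (retardedTime q) (retardedTime x)

theorem fderiv_comp_clm {f : ℝ → ℝ} (hf : Differentiable ℝ f) (L : Minkowski →L[ℝ] ℝ)
    (x v : Minkowski) : fderiv ℝ (fun x => f (L x)) x v = deriv f (L x) * L v := by
  have h : HasFDerivAt (fun x => f (L x)) (deriv f (L x) • L) x :=
    (hf (L x)).hasDerivAt.comp_hasFDerivAt x L.hasFDerivAt
  rw [h.fderiv]
  rfl

theorem contDiff_window (hε : 0 < ε) (p q : Minkowski) : ContDiff ℝ ∞ (window ε p q) :=
  ((contDiff_cutoff hε _ _).comp advancedTime.contDiff).mul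
    ((contDiff_cutoff hε _ _).comp retardedTime.contDiff)

theorem isCausalFunction_windowRamp (hε : 0 < ε) (p q : Minkowski) :
    IsCausalFunction (windowRamp ε p q) :=
  (isCausalFunction_comp_clm (hasBoundedDerivs_ramp hε _ _) (monotone_ramp hε _ _)
    fun _ hv => (isFutureCausal_iff.1 hv).1).add
  (isCausalFunction_comp_clm (hasBoundedDerivs_ramp hε _ _) (monotone_ramp hε _ _)
    fun _ hv => (isFutureCausal_iff.1 hv).2.1)

theorem abs_fderiv_window_le (hε : 0 < ε) (hadv : advancedTime p ≤ advancedTime q)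
    (hret : retardedTime p ≤ retardedTime q) (x : Minkowski) {v : Minkowski}
    (hv : IsFutureCausal v) :
    |fderiv ℝ (window ε p q) x v| ≤ fderiv ℝ (windowRamp ε p q) x v := by
  obtain ⟨hv₁, hv₂, -⟩ := isFutureCausal_iff.1 hv
  have hcut (a b : ℝ) := (contDiff_cutoff hε a b).differentiable (by simp)
  have hramp (a b : ℝ) := (hasBoundedDerivs_ramp hε a b).differentiable
  have hcut₁ := (hcut (advancedTime p) (advancedTime q)).comp advancedTime.differentiable
  have hcut₂ := (hcut (retardedTime p) (retardedTime q)).comp retardedTime.differentiable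
  have hramp₁ := (hramp (advancedTime p) (advancedTime q)).comp advancedTime.differentiable
  have hramp₂ := (hramp (retardedTime p) (retardedTime q)).comp retardedTime.differentiable
  have hwindow : fderiv ℝ (window ε p q) x v = _ :=
    congrArg (· v) (fderiv_mul (hcut₁ x) (hcut₂ x))
  have hwindowRamp : fderiv ℝ (windowRamp ε p q) x v = _ :=
    congrArg (· v) (fderiv_add (hramp₁ x) (hramp₂ x))
  rw [hwindow, hwindowRamp]
  simp only [add_apply, smul_apply, smul_eq_mul, Function.comp_def,
    fderiv_comp_clm (hcut _ _), fderiv_comp_clm (hramp _ _)]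
  rw [add_comm]
  refine (abs_add_le _ _).trans (add_le_add ?_ ?_)
  · rw [abs_mul, abs_of_nonneg (cutoff_nonneg hε hret _), abs_mul, abs_of_nonneg hv₁]
    exact (mul_le_of_le_one_left (by positivity) (cutoff_le_one _ _ _ _)).trans
      (mul_le_mul_of_nonneg_right (abs_deriv_cutoff_le hε _ _ _) hv₁)
  · rw [abs_mul, abs_of_nonneg (cutoff_nonneg hε hadv _), abs_mul, abs_of_nonneg hv₂]
    exact (mul_le_of_le_one_left (by positivity) (cutoff_le_one _ _ _ _)).trans
      (mul_le_mul_of_nonneg_right (abs_deriv_cutoff_le hε _ _ _) hv₂)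

theorem hasCompactSupport_window (hε : 0 < ε) (hadv : advancedTime p ≤ advancedTime q)
    (hret : retardedTime p ≤ retardedTime q) : HasCompactSupport (window ε p q) := by
  have hcont : Continuous fun y : ℝ × ℝ => ((y.1 + y.2) / 2, (y.1 - y.2) / 2) := by fun_prop
  refine HasCompactSupport.intro
    (((isCompact_Icc (a := advancedTime p - ε) (b := advancedTime q + ε)).prod
      (isCompact_Icc (a := retardedTime p - ε) (b := retardedTime q + ε))).image hcont)
    fun x hx => by_contra fun hne => hx ?_
  refine ⟨(advancedTime x, retardedTime x),
    ⟨mem_Icc_of_cutoff_ne_zero hε hadv (left_ne_zero_of_mul hne),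
      mem_Icc_of_cutoff_ne_zero hε hret (right_ne_zero_of_mul hne)⟩, Prod.ext ?_ ?_⟩ <;> simp

theorem window_nonneg (hε : 0 < ε) (hadv : advancedTime p ≤ advancedTime q)
    (hret : retardedTime p ≤ retardedTime q) (x : Minkowski) : 0 ≤ window ε p q x :=
  mul_nonneg (cutoff_nonneg hε hadv _) (cutoff_nonneg hε hret _)

theorem window_le_one (hε : 0 < ε) (hret : retardedTime p ≤ retardedTime q) (x : Minkowski) :
    window ε p q x ≤ 1 :=
  mul_le_one₀ (cutoff_le_one _ _ _ _) (cutoff_nonneg hε hret _) (cutoff_le_one _ _ _ _)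

theorem window_left (hε : 0 < ε) (hadv : advancedTime p ≤ advancedTime q)
    (hret : retardedTime p ≤ retardedTime q) : window ε p q p = 1 := by
  rw [window, cutoff_of_mem hε ⟨le_rfl, hadv⟩, cutoff_of_mem hε ⟨le_rfl, hret⟩, one_mul]

theorem window_right (hε : 0 < ε) (hadv : advancedTime p ≤ advancedTime q)
    (hret : retardedTime p ≤ retardedTime q) : window ε p q q = 1 := by
  rw [window, cutoff_of_mem hε ⟨hadv, le_rfl⟩, cutoff_of_mem hε ⟨hret, le_rfl⟩, one_mul]

theorem windowRamp_left_eq_right (hε : 0 < ε) (hadv : advancedTime p ≤ advancedTime q)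
    (hret : retardedTime p ≤ retardedTime q) : windowRamp ε p q p = windowRamp ε p q q := by
  simp only [windowRamp, ramp_of_mem hε (Set.left_mem_Icc.2 hadv),
    ramp_of_mem hε (Set.left_mem_Icc.2 hret), ramp_of_mem hε (Set.right_mem_Icc.2 hadv),
    ramp_of_mem hε (Set.right_mem_Icc.2 hret)]

end window

section potential

variable {ε R k β : ℝ} {p q : Minkowski} {f g : ℝ → ℝ}

theorem boostedTime_one_one (β : ℝ) : boostedTime β (1, 1) = β := by
  norm_num [boostedTime_apply, advancedTime_apply, retardedTime_apply]

theorem boostedTime_one_neg_one (β : ℝ) : boostedTime β (1, -1) = β⁻¹ := by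
  norm_num [boostedTime_apply, advancedTime_apply, retardedTime_apply]

theorem boostedTime_nonneg (hβ : 0 < β) {v : Minkowski} (hv : IsFutureCausal v) :
    0 ≤ boostedTime β v := by
  obtain ⟨hadv, hret, -⟩ := isFutureCausal_iff.1 hv
  rw [boostedTime_apply]
  positivity

theorem mul_le_fderiv_potential_add_fderiv (hε : 0 < ε)
    (hadv : advancedTime p ≤ advancedTime q) (hret : retardedTime p ≤ retardedTime q)
    (hf : Differentiable ℝ f) (hg : Differentiable ℝ g) (hR : ∀ t, |g t| ≤ R)
    (x : Minkowski) {v : Minkowski} (hv : IsFutureCausal v) :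
    boostedTime β v *
        (deriv f (boostedTime β x) + window ε p q x * deriv g (boostedTime β x)) ≤
      fderiv ℝ (fun y => f (boostedTime β y) + R * windowRamp ε p q y) x v +
        fderiv ℝ (fun y => window ε p q y * g (boostedTime β y)) x v := by
  have hramp := (isCausalFunction_windowRamp hε p q).hasBoundedDerivs.differentiable
  have hwindow := (contDiff_window hε p q).differentiable (by simp)
  have hα := congrArg (· v) (fderiv_fun_add ((hf.comp (boostedTime β).differentiable) x)
    ((hramp x).const_mul R))
  have hρ := congrArg (· v) (fderiv_fun_mul (hwindow x)
    ((hg.comp (boostedTime β).differentiable) x))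
  simp only [Function.comp_def, fderiv_const_mul (hramp x), add_apply, smul_apply, smul_eq_mul,
    fderiv_comp_clm hf, fderiv_comp_clm hg] at hα hρ
  rw [hα, hρ]
  have herror : |g (boostedTime β x) * fderiv ℝ (window ε p q) x v| ≤
      R * fderiv ℝ (windowRamp ε p q) x v := by
    rw [abs_mul]
    exact mul_le_mul (hR _) (abs_fderiv_window_le hε hadv hret x hv) (abs_nonneg _)
      ((abs_nonneg _).trans (hR 0))
  linarith [(abs_le.1 herror).1]

theorem splitPositive_potential (hβ : 0 < β) (hε : 0 < ε)
    (hadv : advancedTime p ≤ advancedTime q) (hret : retardedTime p ≤ retardedTime q)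
    (hf : Differentiable ℝ f) (hg : Differentiable ℝ g) (hR : ∀ t, |g t| ≤ R)
    (hgf : ∀ t, |deriv g t| ≤ deriv f t)
    (hk : ∀ x, window ε p q x ≠ 0 → deriv g (boostedTime β x) ^ 2 +
      (k * g (boostedTime β x)) ^ 2 = deriv f (boostedTime β x) ^ 2) :
    SplitPositive k (fun y => f (boostedTime β y) + R * windowRamp ε p q y)
      (fun y => window ε p q y * g (boostedTime β y)) := by
  intro x
  set T := boostedTime β
  set W := window ε p q x
  have hW : W ^ 2 ≤ 1 :=
    pow_le_one₀ (window_nonneg hε hadv hret x) (window_le_one hε hret x)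
  have hWg : |W * deriv g (T x)| ≤ deriv f (T x) := by
    rw [abs_mul, abs_of_nonneg (window_nonneg hε hadv hret x)]
    exact (mul_le_of_le_one_left (abs_nonneg _) (window_le_one hε hret x)).trans (hgf _)
  obtain ⟨hlower, hupper⟩ := abs_le.1 hWg
  have hplus := mul_le_fderiv_potential_add_fderiv (β := β) hε hadv hret hf hg hR x
    isFutureCausal_one_one
  have hminus := mul_le_fderiv_potential_add_fderiv (β := β) hε hadv hret hf hg.neg
    (fun t => (abs_neg (g t)).trans_le (hR t)) x isFutureCausal_one_neg_one
  simp only [Pi.neg_apply, mul_neg, fderiv_fun_neg, neg_apply, deriv.neg, ← sub_eq_add_neg]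
    at hminus
  rw [boostedTime_one_one] at hplus
  rw [boostedTime_one_neg_one] at hminus
  have hplus_nonneg : 0 ≤ β * (deriv f (T x) + W * deriv g (T x)) :=
    mul_nonneg hβ.le (by linarith)
  have hminus_nonneg : 0 ≤ β⁻¹ * (deriv f (T x) - W * deriv g (T x)) :=
    mul_nonneg (inv_pos.2 hβ).le (by linarith)
  refine ⟨hplus_nonneg.trans hplus, hminus_nonneg.trans hminus, ?_⟩
  calc (k * (W * g (T x))) ^ 2
      ≤ deriv f (T x) ^ 2 - (W * deriv g (T x)) ^ 2 := by
        by_cases h0 : W = 0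
        · simpa [h0] using sq_nonneg (deriv f (T x))
        · have hle := mul_le_of_le_one_left (sq_nonneg (deriv f (T x))) hW
          linear_combination hle + W ^ 2 * hk x h0
    _ = β * (deriv f (T x) + W * deriv g (T x)) * (β⁻¹ * (deriv f (T x) - W * deriv g (T x))) := by
        field_simp
        ring
    _ ≤ _ := mul_le_mul hplus hminus hminus_nonneg (hplus_nonneg.trans hplus)

theorem abs_boostedTime_sub_le_of_window_ne_zero (hβ : 0 < β) (hε : 0 < ε)
    (hadv : advancedTime p ≤ advancedTime q) (hret : retardedTime p ≤ retardedTime q)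
    {x : Minkowski} (hx : window ε p q x ≠ 0) {c h : ℝ} (hp : boostedTime β p = c - h)
    (hq : boostedTime β q = c + h) :
    |boostedTime β x - c| ≤ h + boostedTime β (ε, 0) := by
  obtain ⟨hadvp, hadvq⟩ := mem_Icc_of_cutoff_ne_zero hε hadv (left_ne_zero_of_mul hx)
  obtain ⟨hretp, hretq⟩ := mem_Icc_of_cutoff_ne_zero hε hret (right_ne_zero_of_mul hx)
  have hβ' := inv_pos.2 hβ
  simp only [boostedTime_apply, advancedTime_apply, retardedTime_apply] at *
  rw [abs_le]
  constructor <;> nlinarith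

theorem exists_contDiffBump_add_boostedTime_eq (hβ : 0 < β) (hk : 0 < k) (c : ℝ) {h : ℝ}
    (hh : 0 < h) (hkh : k * h < Real.pi / 2) :
    ∃ (b : ContDiffBump c) (ε : ℝ),
      0 < ε ∧ k * b.rOut < Real.pi / 2 ∧ h + boostedTime β (ε, 0) = b.rIn := by
  obtain ⟨a, hha, ha⟩ := exists_between ((lt_div_iff₀' hk).2 hkh)
  obtain ⟨o, hao, ho⟩ := exists_between ha
  refine ⟨⟨a, o, hh.trans hha, hao⟩, 2 * (a - h) / (β + β⁻¹),
    div_pos (mul_pos two_pos (sub_pos.2 hha)) (by positivity), (lt_div_iff₀' hk).1 ho, ?_⟩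
  rw [boostedTime_apply, advancedTime_apply, retardedTime_apply]
  field_simp
  ring

/-- The diagonal entry `α` of the separating element `[[α, ρ], [ρ, α]]`: up to the multiple of
`windowRamp` which compensates for the cutoff of `ρ`, it is `tan (k * (T - c))` for the boosted
time `T`. -/
def diagPotential (β k ε : ℝ) {c : ℝ} (b : ContDiffBump c) (p q x : Minkowski) : ℝ :=
  clampedTan b k (boostedTime β x) + (Real.cos (k * b.rOut))⁻¹ * windowRamp ε p q x

/-- The off-diagonal entry `ρ` of the separating element `[[α, ρ], [ρ, α]]`: inside the window it
is `1 / cos (k * (T - c))` for the boosted time `T`. -/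
def offDiagPotential (β k ε : ℝ) {c : ℝ} (b : ContDiffBump c) (p q x : Minkowski) : ℝ :=
  window ε p q x * clampedSec b k (boostedTime β x)

variable {c : ℝ} {b : ContDiffBump c}

theorem isCausalFunction_diagPotential (hβ : 0 < β) (hε : 0 < ε) (hk : 0 ≤ k)
    (hkb : k * b.rOut < Real.pi / 2) (p q : Minkowski) :
    IsCausalFunction (diagPotential β k ε b p q) :=
  (isCausalFunction_comp_clm (hasBoundedDerivs_clampedTan hk hkb) (monotone_clampedTan hk hkb)
    fun _ hv => boostedTime_nonneg hβ hv).add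
  ((isCausalFunction_windowRamp hε p q).const_mul (inv_pos.2 (cos_mul_rOut_pos hk hkb)).le)

theorem contDiff_offDiagPotential (hε : 0 < ε) (hk : 0 ≤ k) (hkb : k * b.rOut < Real.pi / 2)
    (β : ℝ) (p q : Minkowski) : ContDiff ℝ ∞ (offDiagPotential β k ε b p q) :=
  (contDiff_window hε p q).mul ((contDiff_clampedSec hk hkb).comp (boostedTime β).contDiff)

theorem splitPositive_diagPotential (hβ : 0 < β) (hε : 0 < ε) (hk : 0 ≤ k)
    (hkb : k * b.rOut < Real.pi / 2) (hadv : advancedTime p ≤ advancedTime q)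
    (hret : retardedTime p ≤ retardedTime q)
    (hb : ∀ x, window ε p q x ≠ 0 → |boostedTime β x - c| ≤ b.rIn) :
    SplitPositive k (diagPotential β k ε b p q) (offDiagPotential β k ε b p q) ∧
      SplitPositive k (diagPotential β k ε b p q) (-offDiagPotential β k ε b p q) := by
  have hf : Differentiable ℝ (clampedTan b k) := differentiable_clampedTan hk hkb
  have hg : Differentiable ℝ (clampedSec b k) :=
    (contDiff_clampedSec hk hkb).differentiable (by simp)
  have hR := abs_clampedSec_le hk hkb
  have hgf := abs_deriv_clampedSec_le hk hkb
  have hsq (x : Minkowski) (hx : window ε p q x ≠ 0) := deriv_clampedSec_sq_add hk hkb (hb x hx)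
  have hneg : -offDiagPotential β k ε b p q =
      fun x => window ε p q x * (-clampedSec b k) (boostedTime β x) :=
    funext fun x => (mul_neg _ _).symm
  refine ⟨splitPositive_potential hβ hε hadv hret hf hg hR hgf hsq, ?_⟩
  rw [hneg]
  exact splitPositive_potential hβ hε hadv hret hf hg.neg (by simpa using hR) (by simpa using hgf)
    (by simpa using hsq)

theorem diagPotential_right_sub_left (hε : 0 < ε) (hadv : advancedTime p ≤ advancedTime q)
    (hret : retardedTime p ≤ retardedTime q) {h : ℝ} (hh : |h| ≤ b.rIn)
    (hp : boostedTime β p = c - h) (hq : boostedTime β q = c + h) :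
    diagPotential β k ε b p q q - diagPotential β k ε b p q p = 2 * Real.tan (k * h) := by
  rw [diagPotential, diagPotential, windowRamp_left_eq_right hε hadv hret, hp, hq,
    sub_eq_add_neg c h, clampedTan_add b k hh, clampedTan_add b k (by rwa [abs_neg]), mul_neg,
    Real.tan_neg]
  ring

theorem offDiagPotential_left (hε : 0 < ε) (hadv : advancedTime p ≤ advancedTime q)
    (hret : retardedTime p ≤ retardedTime q) {h : ℝ} (hh : |h| ≤ b.rIn)
    (hp : boostedTime β p = c - h) :
    offDiagPotential β k ε b p q p = (Real.cos (k * h))⁻¹ := by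
  rw [offDiagPotential, window_left hε hadv hret, hp, sub_eq_add_neg,
    clampedSec_add b k (by rwa [abs_neg]), mul_neg, Real.cos_neg, one_mul]

theorem offDiagPotential_right (hε : 0 < ε) (hadv : advancedTime p ≤ advancedTime q)
    (hret : retardedTime p ≤ retardedTime q) {h : ℝ} (hh : |h| ≤ b.rIn)
    (hq : boostedTime β q = c + h) :
    offDiagPotential β k ε b p q q = (Real.cos (k * h))⁻¹ := by
  rw [offDiagPotential, window_right hε hadv hret, hq, clampedSec_add b k hh, one_mul]

theorem exists_splitPositive (hk : 0 < k) (hadv : 0 < advancedTime (q - p))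
    (hret : 0 < retardedTime (q - p)) (hπ : k * (properTime p q / 2) < Real.pi / 2) :
    ∃ (α : Minkowski → ℝ) (ρ : 𝓢(Minkowski, ℝ)), IsCausalFunction α ∧
      SplitPositive k α ρ ∧ SplitPositive k α (-ρ) ∧
      α q - α p = 2 * Real.tan (k * (properTime p q / 2)) ∧
      ρ p = (Real.cos (k * (properTime p q / 2)))⁻¹ ∧
      ρ q = (Real.cos (k * (properTime p q / 2)))⁻¹ := by
  obtain ⟨β, hβ, hτ⟩ := exists_boostedTime_eq_properTime hadv hret
  have hτ_pos : 0 < properTime p q := Real.sqrt_pos.2 (by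
    rw [neg_metric_self]
    exact mul_pos hadv hret)
  rw [map_sub, sub_pos] at hadv hret
  rw [map_sub] at hτ
  set h := properTime p q / 2 with hh
  have hp : boostedTime β p = boostedTime β p + h - h := (add_sub_cancel_right _ _).symm
  have hq : boostedTime β q = boostedTime β p + h + h := by linarith
  obtain ⟨b, ε, hε, hkb, hεb⟩ :=
    exists_contDiffBump_add_boostedTime_eq hβ hk (boostedTime β p + h) (half_pos hτ_pos) hπ
  have hwindow (x : Minkowski) (hx : window ε p q x ≠ 0) :=
    (abs_boostedTime_sub_le_of_window_ne_zero hβ hε hadv.le hret.le hx hp hq).trans_eq hεb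
  have hhb : |h| ≤ b.rIn := by
    simpa [hq] using hwindow q (by rw [window_right hε hadv.le hret.le]; exact one_ne_zero)
  have hsupp : HasCompactSupport (offDiagPotential β k ε b p q) :=
    (hasCompactSupport_window hε hadv.le hret.le).mul_right
  obtain ⟨hpos, hneg⟩ := splitPositive_diagPotential hβ hε hk.le hkb hadv.le hret.le hwindow
  exact ⟨diagPotential β k ε b p q,
    hsupp.toSchwartzMap (contDiff_offDiagPotential hε hk.le hkb β p q),
    isCausalFunction_diagPotential hβ hε hk.le hkb p q, hpos, hneg,
    diagPotential_right_sub_left hε hadv.le hret.le hhb hp hq,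
    offDiagPotential_left hε hadv.le hret.le hhb hp,
    offDiagPotential_right hε hadv.le hret.le hhb hq⟩

end potential

/-! ## Necessity of the three conditions -/

theorem splitPositive_abs {k : ℝ} {α ρ : Minkowski → ℝ} :
    SplitPositive |k| α ρ ↔ SplitPositive k α ρ := by
  simp only [SplitPositive, mul_pow, sq_abs]

theorem exists_mem_causalCone_expectation_lt {d₁ d₂ : ℝ} (hd : d₁ ≠ d₂) {p q : Minkowski}
    (hadv : 0 < advancedTime (q - p)) (hret : 0 < retardedTime (q - p))
    (hπ : |d₁ - d₂| * (properTime p q / 2) < Real.pi / 2) {z w : Fin 2 → ℂ}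
    (hz : ∀ i, ‖z i‖ = 1) (hw : ∀ i, ‖w i‖ = 1)
    (hzw : (conj (w 0) * w 1).re = -(conj (z 0) * z 1).re)
    (hsin : Real.sin (|d₁ - d₂| * (properTime p q / 2)) < (conj (z 0) * z 1).re) :
    ∃ a ∈ causalCone d₁ d₂, expectation w (a.1 q) < expectation z (a.1 p) := by
  have hk : 0 < |d₁ - d₂| := abs_pos.2 (sub_ne_zero.2 hd)
  obtain ⟨α, ρ, hα, hpos, hneg, hαpq, hρp, hρq⟩ := exists_splitPositive hk hadv hret hπ
  refine ⟨realElement hα hα ρ, realElement_mem_causalCone hα (splitPositive_abs.1 hpos)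
    (splitPositive_abs.1 hneg), ?_⟩
  simp only [expectation_realElement, hz, hw, hzw, hρp, hρq]
  set θ := |d₁ - d₂| * (properTime p q / 2)
  have hθ : 0 ≤ θ := mul_nonneg hk.le (div_nonneg (properTime_nonneg p q) zero_le_two)
  have hcos : 0 < Real.cos θ := Real.cos_pos_of_mem_Ioo ⟨by linarith [Real.pi_pos], hπ⟩
  have htan : Real.tan θ < (Real.cos θ)⁻¹ * (conj (z 0) * z 1).re := by
    rw [Real.tan_eq_sin_div_cos, div_eq_inv_mul]
    exact mul_lt_mul_of_pos_left hsin (inv_pos.2 hcos)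
  linarith

theorem exists_norm_eq_one_re_eq_sin (Δ : ℝ) : ∃ c : ℂ, ‖c‖ = 1 ∧
    c.re = Real.sin (|Δ| / 2) ∧ (c * Complex.exp (Δ * Complex.I)).re = -Real.sin (|Δ| / 2) := by
  set u := Complex.exp ((-(Δ / 2) : ℝ) * Complex.I) with hu
  have hnorm : ‖Complex.I * u‖ = 1 := by
    rw [norm_mul, Complex.norm_I, Complex.norm_exp_ofReal_mul_I, one_mul]
  have hre : (Complex.I * u).re = Real.sin (Δ / 2) := by
    rw [Complex.I_mul_re, Complex.exp_ofReal_mul_I_im, Real.sin_neg, neg_neg]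
  have hre_exp : (Complex.I * u * Complex.exp (Δ * Complex.I)).re = -Real.sin (Δ / 2) := by
    have hexp : u * Complex.exp (Δ * Complex.I) = Complex.exp ((Δ / 2 : ℝ) * Complex.I) := by
      rw [hu, ← Complex.exp_add]
      push_cast
      ring_nf
    rw [mul_assoc, hexp, Complex.I_mul_re, Complex.exp_ofReal_mul_I_im]
  rcases abs_cases Δ with ⟨h, -⟩ | ⟨h, -⟩ <;> rw [h]
  · exact ⟨Complex.I * u, hnorm, hre, hre_exp⟩
  · rw [neg_div, Real.sin_neg]
    exact ⟨-(Complex.I * u), by rw [norm_neg, hnorm], by rw [Complex.neg_re, hre],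
      by rw [neg_mul, Complex.neg_re, hre_exp]⟩

section PureStates

variable {d₁ d₂ : ℝ} {p q : Minkowski} {ξ φ : EuclideanSpace ℂ (Fin 2)}

theorem norm_sq_add_norm_sq (hξ : ‖ξ‖ = 1) : ‖ξ 0‖ ^ 2 + ‖ξ 1‖ ^ 2 = 1 := by
  rw [← Fin.sum_univ_two fun i => ‖ξ i‖ ^ 2, ← EuclideanSpace.norm_sq_eq, hξ, one_pow]

theorem norm_eq_of_latitude_eq (hξ : ‖ξ‖ = 1) (hφ : ‖φ‖ = 1) (h : latitude ξ = latitude φ) :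
    ‖ξ 0‖ = ‖φ 0‖ ∧ ‖ξ 1‖ = ‖φ 1‖ := by
  have hξ' := norm_sq_add_norm_sq hξ
  have hφ' := norm_sq_add_norm_sq hφ
  rw [latitude, latitude] at h
  constructor <;> refine (sq_eq_sq₀ (norm_nonneg _) (norm_nonneg _)).1 ?_ <;> linarith

theorem clm_le_of_causallyPrecedes (hξ : ‖ξ‖ = 1)
    (h : CausallyPrecedes d₁ d₂ (pureState p ξ) (pureState q φ)) {L : Minkowski →L[ℝ] ℝ}
    (hL : ∀ v, IsFutureCausal v → 0 ≤ L v) : L p ≤ L q := by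
  by_contra! hlt
  have hf := isCausalFunction_comp_clm (hasBoundedDerivs_smoothStep hlt)
    (monotone_smoothStep hlt) hL
  have hle := h _ (realElement_zero_mem_causalCone d₁ d₂ hf hf)
  rw [pureState_le_iff (isHermitian_realElement hf hf 0), expectation_realElement,
    expectation_realElement, smoothStep_of_ge hlt le_rfl, smoothStep_of_le hlt le_rfl] at hle
  simp only [zero_apply, zero_mul, mul_zero, mul_one, add_zero, norm_sq_add_norm_sq hξ] at hle
  linarith

theorem precedes_of_causallyPrecedes (hξ : ‖ξ‖ = 1)
    (h : CausallyPrecedes d₁ d₂ (pureState p ξ) (pureState q φ)) : Precedes p q := by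
  rw [precedes_iff, map_sub, map_sub, sub_nonneg, sub_nonneg]
  exact ⟨clm_le_of_causallyPrecedes hξ h fun _ hv => (isFutureCausal_iff.1 hv).1,
    clm_le_of_causallyPrecedes hξ h fun _ hv => (isFutureCausal_iff.1 hv).2.1⟩

theorem latitude_eq_of_causallyPrecedes (hξ : ‖ξ‖ = 1) (hφ : ‖φ‖ = 1)
    (h : CausallyPrecedes d₁ d₂ (pureState p ξ) (pureState q φ)) : latitude ξ = latitude φ := by
  have hconst (c : ℝ) : ‖ξ 0‖ ^ 2 * c ≤ ‖φ 0‖ ^ 2 * c := by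
    have hle := h _ (realElement_zero_mem_causalCone d₁ d₂ (isCausalFunction_const c)
      (isCausalFunction_const 0))
    rw [pureState_le_iff (isHermitian_realElement _ _ 0), expectation_realElement,
      expectation_realElement] at hle
    simpa using hle
  have hξ' := norm_sq_add_norm_sq hξ
  have hφ' := norm_sq_add_norm_sq hφ
  rw [latitude, latitude]
  linarith [hconst 1, hconst (-1)]

theorem ne_zero_of_angularDistance_pos (h₀ : ‖ξ 0‖ = ‖φ 0‖) (h₁ : ‖ξ 1‖ = ‖φ 1‖)
    (h : 0 < angularDistance ξ φ) : ξ 0 ≠ 0 ∧ ξ 1 ≠ 0 := by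
  refine ⟨fun h0 => h.ne' ?_, fun h0 => h.ne' ?_⟩
  · have hφ : φ 0 = 0 := norm_eq_zero.1 (by rw [← h₀, h0, norm_zero])
    simp [angularDistance, longitude, h0, hφ]
  · have hφ : φ 1 = 0 := norm_eq_zero.1 (by rw [← h₁, h0, norm_zero])
    simp [angularDistance, longitude, h0, hφ]

theorem exists_mul_mem_equator (h₀ : ‖ξ 0‖ = ‖φ 0‖) (h₁ : ‖ξ 1‖ = ‖φ 1‖) (hξ₀ : ξ 0 ≠ 0)
    (hξ₁ : ξ 1 ≠ 0) : ∃ s : Fin 2 → ℂ, (∀ i, ‖(s * ξ) i‖ = 1) ∧ (∀ i, ‖(s * φ) i‖ = 1) ∧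
      (conj ((s * ξ) 0) * (s * ξ) 1).re = Real.sin (angularDistance ξ φ / 2) ∧
      (conj ((s * φ) 0) * (s * φ) 1).re = -Real.sin (angularDistance ξ φ / 2) := by
  obtain ⟨c, hc, hre, hre_exp⟩ :=
    exists_norm_eq_one_re_eq_sin (longitude φ - longitude ξ).toReal
  have hconj : conj (ξ 0) ≠ 0 := (map_ne_zero _).2 hξ₀
  refine ⟨![(ξ 0)⁻¹, c * (ξ 1)⁻¹], fun i => ?_, fun i => ?_, ?_, ?_⟩
  · fin_cases i <;> simp [hc, hξ₀, hξ₁]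
  · fin_cases i <;> simp [hc, hξ₀, hξ₁, ← h₀, ← h₁]
  · rw [angularDistance, ← hre]
    simp [hξ₀, hξ₁]
  · have hphase : conj ((ξ 0)⁻¹ * φ 0) * (c * (ξ 1)⁻¹ * φ 1) =
        c * Complex.exp ((longitude φ - longitude ξ).toReal * Complex.I) := by
      rw [map_mul, map_inv₀]
      field_simp
      linear_combination c * conj_mul_eq_mul_exp h₀ h₁
    rw [angularDistance, ← hre_exp, ← hphase]
    rfl

theorem angularDistance_le_of_causallyPrecedes_of_timelike (hd : d₁ ≠ d₂)
    (hadv : 0 < advancedTime (q - p)) (hret : 0 < retardedTime (q - p)) (h₀ : ‖ξ 0‖ = ‖φ 0‖)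
    (h₁ : ‖ξ 1‖ = ‖φ 1‖) (h : CausallyPrecedes d₁ d₂ (pureState p ξ) (pureState q φ)) :
    angularDistance ξ φ ≤ |d₁ - d₂| * properTime p q := by
  by_contra! hlt
  have hτ : 0 ≤ |d₁ - d₂| * properTime p q := mul_nonneg (abs_nonneg _) (properTime_nonneg p q)
  have hπ : angularDistance ξ φ ≤ Real.pi := Real.Angle.abs_toReal_le_pi _
  obtain ⟨hξ₀, hξ₁⟩ := ne_zero_of_angularDistance_pos h₀ h₁ (hτ.trans_lt hlt)
  obtain ⟨s, hnorm_left, hnorm_right, hre_left, hre_right⟩ :=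
    exists_mul_mem_equator h₀ h₁ hξ₀ hξ₁
  have hsin : Real.sin (|d₁ - d₂| * (properTime p q / 2)) < Real.sin (angularDistance ξ φ / 2) :=
    Real.sin_lt_sin_of_lt_of_le_pi_div_two (by linarith [Real.pi_pos]) (by linarith) (by linarith)
  obtain ⟨a, ha, hsep⟩ := exists_mem_causalCone_expectation_lt hd hadv hret (by linarith)
    hnorm_left hnorm_right (by rw [hre_left, hre_right]) (by rwa [hre_left])
  have hle := h _ (diagConj_mem_causalCone (s := s) ha)
  rw [pureState_le_iff (diagConj_mem_causalCone ha).1, expectation_diagConj,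
    expectation_diagConj] at hle
  exact hsep.not_ge hle

theorem angularDistance_le_of_causallyPrecedes (hd : d₁ ≠ d₂)
    (hadv : 0 ≤ advancedTime (q - p)) (hret : 0 ≤ retardedTime (q - p)) (h₀ : ‖ξ 0‖ = ‖φ 0‖)
    (h₁ : ‖ξ 1‖ = ‖φ 1‖) (h : CausallyPrecedes d₁ d₂ (pureState p ξ) (pureState q φ)) :
    angularDistance ξ φ ≤ |d₁ - d₂| * properTime p q := by
  have hperturb (ε : ℝ) (hε : 0 < ε) :
      angularDistance ξ φ ≤ |d₁ - d₂| * properTime p (q + (ε, 0)) := by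
    have hadv' : advancedTime (q + (ε, 0) - p) = advancedTime (q - p) + ε := by
      simp only [map_sub, map_add, advancedTime_apply]
      ring
    have hret' : retardedTime (q + (ε, 0) - p) = retardedTime (q - p) + ε := by
      simp only [map_sub, map_add, retardedTime_apply]
      ring
    have hstay : CausallyPrecedes d₁ d₂ (pureState q φ) (pureState (q + (ε, 0)) φ) := by
      refine causallyPrecedes_of_angularDistance_le ?_ ?_ rfl rfl ?_
      · simpa [advancedTime_apply] using hε.le
      · simpa [retardedTime_apply] using hε.le
      · simpa [angularDistance] using mul_nonneg (abs_nonneg (d₁ - d₂)) (properTime_nonneg _ _)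
    exact angularDistance_le_of_causallyPrecedes_of_timelike hd (by linarith) (by linarith) h₀ h₁
      fun a ha => (h a ha).trans (hstay a ha)
  have hcont : Continuous fun ε : ℝ => |d₁ - d₂| * properTime p (q + (ε, 0)) := by
    simp only [properTime, neg_metric_self]
    fun_prop
  have hlim : Filter.Tendsto (fun ε : ℝ => |d₁ - d₂| * properTime p (q + (ε, 0)))
      (nhdsWithin 0 (Set.Ioi 0)) (nhds (|d₁ - d₂| * properTime p q)) :=
    tendsto_nhdsWithin_of_tendsto_nhds (hcont.tendsto' 0 _ (by simp [← Prod.zero_eq_mk]))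
  exact ge_of_tendsto hlim (Filter.eventually_of_mem self_mem_nhdsWithin hperturb)

end PureStates

end AlmostCommutative

end

theorem theorem3p6 (d₁ d₂ : ℝ) (hd : d₁ ≠ d₂) (p q : AlmostCommutative.Minkowski)
    (ξ φ : EuclideanSpace ℂ (Fin 2)) (hξ : ‖ξ‖ = 1) (hφ : ‖φ‖ = 1) :
    AlmostCommutative.CausallyPrecedes d₁ d₂
        (AlmostCommutative.pureState p ξ) (AlmostCommutative.pureState q φ) ↔
      AlmostCommutative.Precedes p q ∧
      AlmostCommutative.latitude ξ = AlmostCommutative.latitude φ ∧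
      ∃ (γ : ℝ → AlmostCommutative.Minkowski) (a b : ℝ),
        AlmostCommutative.IsCausalCurve γ a b ∧ γ a = p ∧ γ b = q ∧
        AlmostCommutative.angularDistance ξ φ / |d₁ - d₂| ≤
          AlmostCommutative.curveLength γ a b := by
  open AlmostCommutative in
  have hk : 0 < |d₁ - d₂| := abs_pos.2 (sub_ne_zero.2 hd)
  constructor
  · intro h
    have hpq := precedes_of_causallyPrecedes hξ h
    have hlat := latitude_eq_of_causallyPrecedes hξ hφ h
    obtain ⟨hadv, hret⟩ := precedes_iff.1 hpq
    obtain ⟨h₀, h₁⟩ := norm_eq_of_latitude_eq hξ hφ hlat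
    obtain ⟨γ, a, b, hγ, ha, hb, hlen⟩ :=
      exists_isCausalCurve_curveLength_eq_properTime hadv hret
    refine ⟨hpq, hlat, γ, a, b, hγ, ha, hb, ?_⟩
    rw [hlen, div_le_iff₀' hk]
    exact angularDistance_le_of_causallyPrecedes hd hadv hret h₀ h₁ h
  · rintro ⟨hpq, hlat, γ, a, b, hγ, rfl, rfl, hlen⟩
    obtain ⟨hadv, hret⟩ := precedes_iff.1 hpq
    obtain ⟨h₀, h₁⟩ := norm_eq_of_latitude_eq hξ hφ hlat
    refine causallyPrecedes_of_angularDistance_le hadv hret h₀ h₁ ?_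
    rw [← div_le_iff₀' hk]
    exact hlen.trans hγ.curveLength_le_properTime
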